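/- **Setting.** Let $\beta\ge 0$, $b>0$, $c\ge 0$, let $\phi(z)=bz+cz^2$, and let $$v_t(\lambda)=\frac{e^{-bt}\lambda}{1+\frac{c\lambda}{b}(1-e^{-bt})}$$ be the solution of $\partial_t v_t(\lambda)=-\phi(v_t(\lambda))$, $v_0(\lambda)=\lambda$. Let $\mu(dz)=(z\wedge 1)\,dz$ on $(0,\infty)$, $\|f\|_\mu=\int_0^\infty |f|\,d\mu$, and let $K$ be the set of non-negative, right-continuous functions on $(0,\infty)$ that are of locally bounded variation on $(0,\infty)$ and satisfy $\|f\|_\mu<\infty$. Fix $R>0$ and $\tilde k_R\in K$ with $\|\tilde k_R\|_\mu\le R$, and put $$\tilde K_R=\{k\in K:\ k\le \tilde k_R \text{ on }(0,\infty),\ V_{2^i}^{2^{i+1}}(k)\le R\ \text{ for all } i\in\mathbb Z\},$$ where $V_x^y(k)$ is the total variation of $k$ on $[x,y]$. For $k\in K$ and $\lambda>0$ put $$Tk(\lambda)=-\beta\int_0^\infty v_s(\lambda)\,ds-\int_0^\infty\!\!\int_0^\infty\big(1-e^{-zv_s(\lambda)}\big)k(z)\,dz\,ds .$$ Let $w$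 be a bounded, non-negative, measurable weight such that the support $A_w$ of the measure $w(\lambda)d\lambda$ on $(0,\infty)$ (taken in $\mathbb R$) is compact and contains $[0,a]$ for some $a>0$; let $L^2(w)$ have the norm $\|f\|_w^2=\int_0^\infty |f(\lambda)|^2w(\lambda)\,d\lambda$, functions being identified when they agree $w(\lambda)d\lambda$-almost everywhere. Let $\tilde\Psi_R\subset L^2(w)$ be the set of all $Tk$ with $k\in\tilde K_R$ for which the double integral in $Tk(\lambda)$ is finite for all $\lambda>0$. Let $k\in\tilde K_R$ and let $(X_t)_{t\ge0}$ be a stationary CBI-process with Lévy density $k$, that is, a stationary Markov process on $[0,\infty)$ whose transition semigroup $(P_t)_{t\ge 0}$ satisfies, for all $t,x,\lambda\ge0$, $$\int_0^\infty e^{-\lambda y}P_t(x,dy)=\exp\Big\{-xv_t(\lambda)-\int_0^t\psi(v_s(\lambda))\,ds\Big\},\qquad \psi(z)=\beta z+\int_0^\infty(1-e^{-zu})k(u)\,du .$$ Put $g=Tk$ and, for $n\ge1$, $g_{1,n}(\lambda)=\log\big(\frac1n\sum_{j=1}^n e^{-\lambda X_j}\big)$. **Theorem.** Let $\varepsilon_n\ge0$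 (possibly random) with $\varepsilon_n\to0$ almost surely. Almost surely for every $n\ge1$, let $\hat g_{1,n}\in\tilde\Psi_R$ be a minimizer of the least squares criterion up to $\varepsilon_n$, i.e. $$\|g_{1,n}-\hat g_{1,n}\|_w^2\le\|g_{1,n}-h\|_w^2+\varepsilon_n\quad\text{for all } h\in\tilde\Psi_R$$ (for $\varepsilon_n=0$ this says $\hat g_{1,n}=\arg\min_{h\in\tilde\Psi_R}\|g_{1,n}-h\|_w^2$), and let $\hat k_{1,n}=T^{-1}\hat g_{1,n}$, i.e. $\hat k_{1,n}\in\tilde K_R$, $T\hat k_{1,n}$ is finite on $(0,\infty)$, and $T\hat k_{1,n}=\hat g_{1,n}$ in $L^2(w)$. Then, as $n\to\infty$, $$\|\hat g_{1,n}-g\|_w^2=\int_0^\infty|\hat g_{1,n}(\lambda)-g(\lambda)|^2w(\lambda)\,d\lambda\longrightarrow0\quad\text{almost surely}$$ and $$\|\hat k_{1,n}-k\|_\mu\longrightarrow0\quad\text{almost surely.}$$ -/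

import Mathlib

open MeasureTheory ProbabilityTheory Set Filter Topology
open scoped NNReal ENNReal

namespace CBI

noncomputable section

/-- The branching mechanism `φ(z) = b z + c z²`. -/
def phi (b c z : ℝ) : ℝ := b * z + c * z ^ 2

/-- The function `t ↦ v_t(l)`: the solution of `∂ₜ v = -φ(v)`, `v_0 = l`, for `b > 0`, `c ≥ 0`. -/
def v (b c t l : ℝ) : ℝ :=
  Real.exp (-b * t) * l / (1 + c * l / b * (1 - Real.exp (-b * t)))

theorem v_zero (b c l : ℝ) : v b c 0 l = l := by
  simp [v]

theorem v_denom_pos {b c t l : ℝ} (hb : 0 < b) (hc : 0 ≤ c) (ht : 0 ≤ t) (hl : 0 ≤ l) :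
    0 < 1 + c * l / b * (1 - Real.exp (-b * t)) := by
  have h1 : Real.exp (-b * t) ≤ 1 := Real.exp_le_one_iff.2 (by nlinarith)
  have h2 : 0 ≤ c * l / b := by positivity
  nlinarith [mul_nonneg h2 (sub_nonneg.2 h1)]

theorem v_hasDerivAt {b c t l : ℝ} (hb : 0 < b) (hc : 0 ≤ c) (ht : 0 ≤ t) (hl : 0 ≤ l) :
    HasDerivAt (fun s => v b c s l) (-phi b c (v b c t l)) t := by
  have hD := (v_denom_pos hb hc ht hl).ne'
  have he : HasDerivAt (fun s : ℝ => Real.exp (-b * s)) (Real.exp (-b * t) * (-b)) t := by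
    have := ((hasDerivAt_id t).const_mul (-b)).exp
    simpa using this
  have h := (he.mul_const l).div (((he.const_sub 1).const_mul (c * l / b)).const_add 1) hD
  refine h.congr_deriv ?_
  have hb' := hb.ne'
  unfold phi v
  generalize hE : Real.exp (-b * t) = E at *
  generalize hq : 1 + c * l / b * (1 - E) = D at *
  field_simp
  ring

/-- The immigration mechanism `ψ(z) = β z + ∫₀^∞ (1 - e^{-z u}) k(u) du`, that is, with drift `β`
and Lévy measure `n(du) = k(u) du` on `(0, ∞)`. -/
def psi (β : ℝ) (k : ℝ → ℝ) (z : ℝ) : ℝ :=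
  β * z + ∫ u in Ioi (0 : ℝ), (1 - Real.exp (-z * u)) * k u

/-- `κ` is the transition semigroup of the CBI-process with mechanisms `φ` and `ψ`: every `κ t x`
is a probability measure on `[0, ∞)` whose Laplace transform at `l ≥ 0` is
`exp (-x v_t(l) - ∫₀ᵗ ψ(v_s(l)) ds)`. -/
def IsTransitionSemigroup (β b c : ℝ) (k : ℝ → ℝ) (κ : ℝ≥0 → Kernel ℝ≥0 ℝ≥0) : Prop :=
  ∀ (t x : ℝ≥0), IsProbabilityMeasure (κ t x) ∧ ∀ l : ℝ, 0 ≤ l →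
    ∫ y, Real.exp (-l * (y : ℝ)) ∂(κ t x)
      = Real.exp (-(x : ℝ) * v b c t l - ∫ s in (0 : ℝ)..(t : ℝ), psi β k (v b c s l))

/-- `X` is a CBI-process: a Markov process on `[0, ∞)`, with respect to its own filtration, whose
transition semigroup is that of the mechanisms `φ` and `ψ`. -/
def IsCBIProcess {Ω : Type*} [MeasurableSpace Ω] (P : Measure Ω) (β b c : ℝ) (k : ℝ → ℝ)
    (X : ℝ≥0 → Ω → ℝ≥0) : Prop :=
  (∀ t, Measurable (X t)) ∧
  ∃ κ : ℝ≥0 → Kernel ℝ≥0 ℝ≥0, IsTransitionSemigroup β b c k κ ∧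
    ∀ (s t : ℝ≥0) (B : Set ℝ≥0), MeasurableSet B →
      P[(X (s + t) ⁻¹' B).indicator (fun _ => (1 : ℝ)) |
          ⨆ u : {u : ℝ≥0 // u ≤ s}, MeasurableSpace.comap (X u) inferInstance]
        =ᵐ[P] fun ω => (κ t (X s ω)).real B

/-- Stationarity: the law of the process on path space is invariant under time shifts. -/
def IsStationaryProcess {Ω : Type*} [MeasurableSpace Ω] (P : Measure Ω)
    (X : ℝ≥0 → Ω → ℝ≥0) : Prop :=
  ∀ h : ℝ≥0, IdentDistrib (fun ω (t : ℝ≥0) => X (t + h) ω) (fun ω (t : ℝ≥0) => X t ω) P P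

/-- The distance `‖f - g‖` of `L¹(μ)`, where `μ(dz) = (z ∧ 1) dz` on `(0, ∞)`. -/
def distMu (f g : ℝ → ℝ) : ℝ≥0∞ :=
  ∫⁻ z in Ioi (0 : ℝ), ENNReal.ofReal (|f z - g z| * min z 1)

/-- The class `K` of the non-negative, right-continuous functions on `(0, ∞)` that are of locally
bounded variation there and belong to `L¹(μ)`. -/
structure IsInK (k : ℝ → ℝ) : Prop where
  nonneg : ∀ z, 0 < z → 0 ≤ k z
  rightCont : ∀ z, 0 < z → ContinuousWithinAt k (Ici z) z
  locallyBV : LocallyBoundedVariationOn k (Ioi 0)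
  integrable : distMu k 0 < ∞

/-- The class `K̃_R` determined by `R` and the envelope `kt`: the elements of `K` that are bounded
by `kt` and whose variation on each dyadic interval `[2^i, 2^(i+1)]` is at most `R`. -/
structure IsInKR (R : ℝ) (kt k : ℝ → ℝ) : Prop where
  inK : IsInK k
  le_envelope : ∀ z, 0 < z → k z ≤ kt z
  variation_le : ∀ i : ℤ, eVariationOn k (Icc ((2 : ℝ) ^ i) ((2 : ℝ) ^ (i + 1))) ≤ ENNReal.ofReal R

/-- The double integral in the definition of `T k` is finite, i.e. `T k` is a real function. -/
def TFinite (b c : ℝ) (k : ℝ → ℝ) : Prop :=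
  ∀ l : ℝ, 0 < l → ∫⁻ s in Ioi (0 : ℝ), ∫⁻ z in Ioi (0 : ℝ),
    ENNReal.ofReal ((1 - Real.exp (-z * v b c s l)) * k z) < ∞

/-- `T k (l) = -β ∫₀^∞ v_s(l) ds - ∫₀^∞ ∫₀^∞ (1 - e^{-z v_s(l)}) k(z) dz ds`. -/
def T (β b c : ℝ) (k : ℝ → ℝ) (l : ℝ) : ℝ :=
  -β * (∫ s in Ioi (0 : ℝ), v b c s l)
    - ∫ s in Ioi (0 : ℝ), ∫ z in Ioi (0 : ℝ), (1 - Real.exp (-z * v b c s l)) * k z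

/-- The measure `w(l) dl` on `(0, ∞)`. -/
def weightMeasure (w : ℝ → ℝ) : Measure ℝ :=
  (volume.restrict (Ioi (0 : ℝ))).withDensity (fun l => ENNReal.ofReal (w l))

/-- A weight function: bounded, non-negative, with compact support `A_w ⊇ [0, a]` for some `a > 0`.
The support is that of `w(l) dl`, so that it does not depend on null sets. -/
structure IsWeight (w : ℝ → ℝ) : Prop where
  measurable : Measurable w
  nonneg : ∀ l, 0 < l → 0 ≤ w l
  bounded : ∃ C : ℝ, ∀ l, 0 < l → w l ≤ C
  compact_support : IsCompact (weightMeasure w).support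
  support_near_zero : ∃ a : ℝ, 0 < a ∧ Icc 0 a ⊆ (weightMeasure w).support

/-- The squared distance `‖f - g‖²` of `L²(w)`. -/
def sqDistW (w f g : ℝ → ℝ) : ℝ≥0∞ :=
  ∫⁻ l in Ioi (0 : ℝ), ENNReal.ofReal (|f l - g l| ^ 2 * w l)

/-- `k` is a preimage under `T` of `g` that lies in `K̃_R`, as elements of `L²(w)`. -/
def IsTPreimage (β b c R : ℝ) (kt w g k : ℝ → ℝ) : Prop :=
  IsInKR R kt k ∧ TFinite b c k ∧ g =ᵐ[weightMeasure w] T β b c k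

/-- `g` belongs to `Ψ̃_R = T(K̃_R)`, as an element of `L²(w)`. -/
def IsInPsiR (β b c R : ℝ) (kt w g : ℝ → ℝ) : Prop :=
  ∃ k, IsTPreimage β b c R kt w g k

/-- `g` minimizes `‖f - g‖²` over `Ψ̃_R`, up to `ε`. For `ε = 0` it is the exact minimizer
`argmin_{g ∈ Ψ̃_R} ‖f - g‖²`. -/
def IsMinimizerUpTo (ε : ℝ≥0∞) (β b c R : ℝ) (kt w f g : ℝ → ℝ) : Prop :=
  IsInPsiR β b c R kt w g ∧
    ∀ g', IsInPsiR β b c R kt w g' → sqDistW w f g ≤ sqDistW w f g' + ε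

/-- The logarithm `g_{1,n}` of the empirical Laplace transform
`L_{1,n}(l) = (1/n) ∑_{j=1}^n e^{-l X_j}`. -/
def logEmpiricalLaplace {Ω : Type*} (X : ℝ≥0 → Ω → ℝ≥0) (n : ℕ) (ω : Ω) (l : ℝ) : ℝ :=
  Real.log ((1 / (n : ℝ)) * ∑ j ∈ Finset.Icc 1 n, Real.exp (-l * (X (j : ℝ≥0) ω : ℝ)))

end

end CBI

/-! ### A pointwise ergodic theorem from decaying correlations. -/

section Ergodic

variable {α : Type*} {τ : α → α} {f : α → ℝ}

/-! Two facts combine: the log empirical Laplace transform is consistent for `g` in `L²(w)`, and `T`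
has a continuous inverse on the constrained class. Stationarity makes `T k` finite, so `g` is itself
a competitor in the least squares problem. A near-minimizer is then within a constant multiple of
the empirical error plus `ε n` of `g`, which gives the first limit; continuity of the inverse turns
it into the second.

Consistency. Letting `t → ∞` in the stationarity equation for the Laplace transform `L` of `X 0`
gives `T k = log L` (`T_eq_log_laplace`). The transition kernel forgets its initial state because
`v_t(l) → 0`, so the autocovariances of `exp (-l X)` vanish (`tendsto_autocovariance`). For bounded
observables this yields almost sure convergence of averages: by the maximal ergodic theorem, the
invariant set where the upper limit exceeds `ε` carries an integral of at least `ε` times its mass,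
whereas the variance bound forces that integral to be zero. Fubini and dominated convergence on the
bounded support of the weight lift this to `L²(w)`.

Inverse. The dyadic variation bounds and the envelope give compactness of the class for almost
everywhere convergence, by Helly (`exists_subseq_tendsto_of_isInKR`). The difficulty is that the
envelope is only in `L¹(μ)`: `T` of it may be infinite, so `T` cannot be passed to a limit by
domination. Differences of `T` along an orbit of the flow, however, are integrals of `ψ` over finite
time intervals (`T_v`), and these do converge. Hence the limit density and `k` have equal
finite-time integrals. Differentiating in time identifies the two `ψ` near zero, and uniqueness of
Laplace transforms identifies the densities (`ae_eq_of_psi_eqOn`). The envelope dominates in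
`L¹(μ)`, so convergence holds along the subsequence, and therefore for the whole sequence. -/

/-- The running maximum of the Birkhoff sums, including the empty sum. -/
noncomputable def birkhoffMax (τ : α → α) (f : α → ℝ) (N : ℕ) (x : α) : ℝ :=
  (Finset.range (N + 1)).sup' Finset.nonempty_range_add_one fun n => birkhoffSum τ f n x

theorem birkhoffSum_le_birkhoffMax {n N : ℕ} (h : n ≤ N) (x : α) :
    birkhoffSum τ f n x ≤ birkhoffMax τ f N x :=
  Finset.le_sup' (fun n => birkhoffSum τ f n x) (Finset.mem_range.2 (by lia))

theorem birkhoffMax_nonneg (N : ℕ) (x : α) : 0 ≤ birkhoffMax τ f N x := by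
  simpa using birkhoffSum_le_birkhoffMax (τ := τ) (f := f) (Nat.zero_le N) x

theorem exists_birkhoffMax_eq (τ : α → α) (f : α → ℝ) (N : ℕ) (x : α) :
    ∃ n ≤ N, birkhoffMax τ f N x = birkhoffSum τ f n x := by
  obtain ⟨n, hn, h⟩ := Finset.exists_mem_eq_sup' (s := Finset.range (N + 1))
    Finset.nonempty_range_add_one fun n => birkhoffSum τ f n x
  exact ⟨n, by simpa [Nat.lt_succ_iff] using hn, h⟩

/-- A positive maximum is attained by a nonempty sum. Removing its first term `f x` leaves a shorter
sum started at `τ x`. -/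
theorem birkhoffMax_sub_le {N : ℕ} {x : α} (h : 0 < birkhoffMax τ f N x) :
    birkhoffMax τ f N x - birkhoffMax τ f N (τ x) ≤ f x := by
  obtain ⟨n, hn, hx⟩ := exists_birkhoffMax_eq τ f N x
  cases n with
  | zero => simp [hx] at h
  | succ n =>
    have := birkhoffSum_le_birkhoffMax (τ := τ) (f := f) (show n ≤ N by lia) (τ x)
    rw [hx, birkhoffSum_succ']
    linarith

theorem birkhoffMax_mono {N M : ℕ} (h : N ≤ M) (x : α) :
    birkhoffMax τ f N x ≤ birkhoffMax τ f M x := by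
  obtain ⟨n, hn, hx⟩ := exists_birkhoffMax_eq τ f N x
  exact hx ▸ birkhoffSum_le_birkhoffMax (hn.trans h) x

/-- The set of points where the upper limit of the Birkhoff averages exceeds `ε`. -/
def birkhoffUpperSet (τ : α → α) (f : α → ℝ) (ε : ℝ) : Set α :=
  {x | ∃ m : ℕ, ∃ᶠ n in atTop, ε + 1 / ((m : ℝ) + 1) < birkhoffAverage ℝ τ f n x}

/-- The gap `1 / (m + 1)` in the definition leaves room: a vanishing difference of averages is
absorbed by passing to a smaller gap. -/
theorem birkhoffUpperSet_congr {x y : α} {ε : ℝ}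
    (h : Tendsto (fun n => birkhoffAverage ℝ τ f n y - birkhoffAverage ℝ τ f n x) atTop (𝓝 0))
    (hx : x ∈ birkhoffUpperSet τ f ε) : y ∈ birkhoffUpperSet τ f ε := by
  obtain ⟨m, hm⟩ := hx
  obtain ⟨p, hp⟩ := exists_nat_one_div_lt (show (0 : ℝ) < 1 / ((m : ℝ) + 1) by positivity)
  refine ⟨p, ?_⟩
  have h1 := h.eventually (lt_mem_nhds
    (show 1 / ((p : ℝ) + 1) - 1 / ((m : ℝ) + 1) < 0 by linarith))
  refine (hm.and_eventually h1).mono fun n hn => ?_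
  linarith [hn.1, hn.2]

theorem preimage_birkhoffUpperSet {C : ℝ} (hC : ∀ x, |f x| ≤ C) (ε : ℝ) :
    τ ⁻¹' birkhoffUpperSet τ f ε = birkhoffUpperSet τ f ε := by
  have hb (x : α) : Tendsto (fun n => birkhoffAverage ℝ τ f n (τ x) - birkhoffAverage ℝ τ f n x)
      atTop (𝓝 0) := by
    refine tendsto_birkhoffAverage_apply_sub_birkhoffAverage ℝ ?_
    refine (Metric.isBounded_closedBall (x := (0 : ℝ)) (r := C)).subset ?_
    rintro _ ⟨n, rfl⟩
    simpa using hC _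
  ext x
  exact ⟨birkhoffUpperSet_congr (by simpa using (hb x).neg), birkhoffUpperSet_congr (hb x)⟩

theorem birkhoffSum_indicator_of_mem {D : Set α} (hD : τ ⁻¹' D = D) {x : α} (hx : x ∈ D) (n : ℕ) :
    birkhoffSum τ (D.indicator f) n x = birkhoffSum τ f n x := by
  refine Finset.sum_congr rfl fun i _ => Set.indicator_of_mem (?_ : τ^[i] x ∈ D) _
  clear * - hD hx
  induction i with
  | zero => exact hx
  | succ i ih =>
    rw [Function.iterate_succ_apply']
    exact hD.symm.subset ih

theorem birkhoffSum_indicator_of_notMem {D : Set α} (hD : τ ⁻¹' D = D) {x : α} (hx : x ∉ D)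
    (n : ℕ) : birkhoffSum τ (D.indicator f) n x = 0 := by
  refine Finset.sum_eq_zero fun i _ => Set.indicator_of_notMem (?_ : τ^[i] x ∉ D) _
  clear * - hD hx
  induction i with
  | zero => exact hx
  | succ i ih =>
    rw [Function.iterate_succ_apply']
    exact fun h => ih (hD.subset h)

variable [MeasurableSpace α] {μ : Measure α}

theorem measurable_birkhoffSum (hτ : Measurable τ) (hf : Measurable f) (n : ℕ) :
    Measurable (birkhoffSum τ f n) := by
  unfold birkhoffSum
  exact Finset.measurable_fun_sum _ fun i _ => hf.comp (hτ.iterate i)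

theorem integrable_birkhoffSum (hτ : MeasurePreserving τ μ μ) (hf : Integrable f μ) (n : ℕ) :
    Integrable (birkhoffSum τ f n) μ := by
  unfold birkhoffSum
  exact integrable_finsetSum _ fun i _ => (hτ.iterate i).integrable_comp_of_integrable hf

theorem measurable_birkhoffMax (hτ : Measurable τ) (hf : Measurable f) (N : ℕ) :
    Measurable (birkhoffMax τ f N) := by
  unfold birkhoffMax
  exact Finset.measurable_range_sup'' fun n _ => measurable_birkhoffSum hτ hf n

theorem integrable_birkhoffMax (hτ : MeasurePreserving τ μ μ) (hfm : Measurable f)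
    (hf : Integrable f μ) (N : ℕ) : Integrable (birkhoffMax τ f N) μ := by
  refine Integrable.mono' (g := fun x => ∑ n ∈ Finset.range (N + 1), |birkhoffSum τ f n x|)
    (integrable_finsetSum _ fun n _ => (integrable_birkhoffSum hτ hf n).abs)
    (measurable_birkhoffMax hτ.measurable hfm N).aestronglyMeasurable (ae_of_all _ fun x => ?_)
  obtain ⟨n, hn, hx⟩ := exists_birkhoffMax_eq τ f N x
  rw [hx, Real.norm_eq_abs]
  exact Finset.single_le_sum (f := fun n => |birkhoffSum τ f n x|) (fun _ _ => abs_nonneg _)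
    (Finset.mem_range.2 (by lia))

/-- The maximal ergodic theorem. -/
theorem setIntegral_birkhoffMax_pos_nonneg (hτ : MeasurePreserving τ μ μ) (hfm : Measurable f)
    (hf : Integrable f μ) (N : ℕ) : 0 ≤ ∫ x in {x | 0 < birkhoffMax τ f N x}, f x ∂μ := by
  have hMm := measurable_birkhoffMax hτ.measurable hfm N
  have hM := integrable_birkhoffMax hτ hfm hf N
  have hMτ : Integrable (fun x => birkhoffMax τ f N (τ x)) μ := hτ.integrable_comp_of_integrable hM
  have hA : MeasurableSet {x | 0 < birkhoffMax τ f N x} := measurableSet_lt measurable_const hMm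
  have h1 : ∫ x in {x | 0 < birkhoffMax τ f N x},
      (birkhoffMax τ f N x - birkhoffMax τ f N (τ x)) ∂μ
      ≤ ∫ x in {x | 0 < birkhoffMax τ f N x}, f x ∂μ :=
    setIntegral_mono_on (hM.sub hMτ).integrableOn hf.integrableOn hA fun x hx =>
      birkhoffMax_sub_le hx
  rw [integral_sub hM.integrableOn hMτ.integrableOn] at h1
  have h2 : ∫ x in {x | 0 < birkhoffMax τ f N x}, birkhoffMax τ f N x ∂μ
      = ∫ x, birkhoffMax τ f N x ∂μ := by
    refine setIntegral_eq_integral_of_forall_compl_eq_zero fun x hx => ?_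
    exact le_antisymm (not_lt.1 hx) (birkhoffMax_nonneg N x)
  have h3 : ∫ x in {x | 0 < birkhoffMax τ f N x}, birkhoffMax τ f N (τ x) ∂μ
      ≤ ∫ x, birkhoffMax τ f N (τ x) ∂μ :=
    setIntegral_le_integral hMτ (ae_of_all _ fun x => birkhoffMax_nonneg N _)
  have h4 : ∫ x, birkhoffMax τ f N (τ x) ∂μ = ∫ x, birkhoffMax τ f N x ∂μ := by
    rw [← integral_map hτ.aemeasurable (by rw [hτ.map_eq]; exact hM.1), hτ.map_eq]
  linarith

theorem measurableSet_birkhoffUpperSet (hτ : Measurable τ) (hf : Measurable f) (ε : ℝ) :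
    MeasurableSet (birkhoffUpperSet τ f ε) := by
  have : birkhoffUpperSet τ f ε = ⋃ m : ℕ, ⋂ N : ℕ, ⋃ n : ℕ, ⋃ _ : N ≤ n,
      {x | ε + 1 / ((m : ℝ) + 1) < birkhoffAverage ℝ τ f n x} := by
    ext x
    simp [birkhoffUpperSet, frequently_atTop]
  rw [this]
  refine .iUnion fun m => .iInter fun N => .iUnion fun n => .iUnion fun _ => ?_
  refine measurableSet_lt measurable_const ?_
  exact (measurable_birkhoffSum hτ hf n).const_mul ((n : ℝ)⁻¹)

/-- The maximal ergodic theorem is applied to `f - ε` cut off to the invariant set `D`. The sets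
where the running maximum is positive increase to exactly `D`, so the inequality passes to the
limit. -/
theorem mul_measure_birkhoffUpperSet_le [IsFiniteMeasure μ] (hτ : MeasurePreserving τ μ μ)
    (hfm : Measurable f) {C : ℝ} (hC : ∀ x, |f x| ≤ C) (ε : ℝ) :
    ε * μ.real (birkhoffUpperSet τ f ε) ≤ ∫ x in birkhoffUpperSet τ f ε, f x ∂μ := by
  set D := birkhoffUpperSet τ f ε with hDdef
  have hD : MeasurableSet D := measurableSet_birkhoffUpperSet hτ.measurable hfm ε
  have hinv : τ ⁻¹' D = D := preimage_birkhoffUpperSet hC ε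
  have hf : Integrable f μ := Integrable.of_bound hfm.aestronglyMeasurable C (ae_of_all _ hC)
  have hfε : Integrable (fun x => f x - ε) μ := hf.sub (integrable_const ε)
  set g : α → ℝ := D.indicator fun x => f x - ε
  have hgm : Measurable g := (hfm.sub_const ε).indicator hD
  have hg : Integrable g μ := hfε.indicator hD
  have hmax := setIntegral_birkhoffMax_pos_nonneg hτ hgm hg
  have hU : (⋃ N, {x | 0 < birkhoffMax τ g N x}) = D := by
    ext x
    simp only [mem_iUnion, mem_ofPred_eq]
    constructor
    · rintro ⟨N, hN⟩
      by_contra hx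
      obtain ⟨n, -, hn⟩ := exists_birkhoffMax_eq τ g N x
      rw [hn, birkhoffSum_indicator_of_notMem hinv hx] at hN
      exact hN.false
    · intro hx
      have hx' := hx
      obtain ⟨m, hm⟩ := hx'
      obtain ⟨n, hn1, hn⟩ := (hm.and_eventually (eventually_ge_atTop 1)).exists
      refine ⟨n, lt_of_lt_of_le ?_ (birkhoffSum_le_birkhoffMax le_rfl x)⟩
      rw [birkhoffSum_indicator_of_mem hinv hx]
      have h0 : (0 : ℝ) < n := by exact_mod_cast hn
      have h1 : ε < birkhoffAverage ℝ τ f n x :=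
        lt_of_le_of_lt (le_add_of_nonneg_right (by positivity)) hn1
      rw [birkhoffAverage, smul_eq_mul, ← div_eq_inv_mul, lt_div_iff₀ h0] at h1
      have h2 : birkhoffSum τ (fun x => f x - ε) n x = birkhoffSum τ f n x - n * ε := by
        simp [birkhoffSum, Finset.sum_sub_distrib]
      rw [h2]
      linarith
  have hlim := tendsto_setIntegral_of_monotone (μ := μ) (f := g)
    (s := fun N => {x | 0 < birkhoffMax τ g N x})
    (fun N => measurableSet_lt measurable_const (measurable_birkhoffMax hτ.measurable hgm N))
    (fun N M h x hx => lt_of_lt_of_le hx (birkhoffMax_mono h x)) hg.integrableOn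
  rw [hU] at hlim
  have h0 : 0 ≤ ∫ x in D, g x ∂μ := ge_of_tendsto' hlim hmax
  rw [setIntegral_congr_fun hD (g := fun x => f x - ε)
    (fun x hx => Set.indicator_of_mem hx _), integral_sub hf.integrableOn
    (integrable_const ε).integrableOn, setIntegral_const, smul_eq_mul] at h0
  linarith

theorem setIntegral_birkhoffSum {D : Set α} (hD : MeasurableSet D) (hinv : τ ⁻¹' D = D)
    (hτ : MeasurePreserving τ μ μ) (hf : Integrable f μ) (n : ℕ) :
    ∫ x in D, birkhoffSum τ f n x ∂μ = n * ∫ x in D, f x ∂μ := by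
  have hτD : MeasurePreserving τ (μ.restrict D) (μ.restrict D) := by
    simpa [hinv] using hτ.restrict_preimage hD
  have hfD : Integrable f (μ.restrict D) := hf.integrableOn
  unfold birkhoffSum
  rw [integral_finsetSum (f := fun i x => f (τ^[i] x)) _
    fun i _ => (hτD.iterate i).integrable_comp_of_integrable hfD]
  have (i : ℕ) : ∫ x in D, f (τ^[i] x) ∂μ = ∫ x in D, f x ∂μ := by
    rw [← integral_map (hτD.iterate i).aemeasurable
      (by rw [(hτD.iterate i).map_eq]; exact hfD.1), (hτD.iterate i).map_eq]
  simp [this]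

/-- Writing the sum of length `n + 1` as `f` plus the sum of length `n` composed with `τ` and
squaring, each induction step adds only correlations of `f` with its iterates. -/
theorem integral_sq_birkhoffSum_le [IsFiniteMeasure μ] (hτ : MeasurePreserving τ μ μ)
    (hfm : Measurable f) {C : ℝ} (hC : ∀ x, |f x| ≤ C) (n : ℕ) :
    ∫ x, birkhoffSum τ f n x ^ 2 ∂μ
      ≤ 2 * n * ∑ j ∈ Finset.range n, |∫ x, f x * f (τ^[j] x) ∂μ| := by
  set r : ℕ → ℝ := fun j => ∫ x, f x * f (τ^[j] x) ∂μ with hr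
  have hSb (n : ℕ) (x : α) : |birkhoffSum τ f n x| ≤ n * C := by
    refine (Finset.abs_sum_le_sum_abs _ _).trans ?_
    simpa using Finset.sum_le_card_nsmul (Finset.range n) (fun i => |f (τ^[i] x)|) C
      fun i _ => hC _
  have hSm := measurable_birkhoffSum hτ.measurable hfm
  have hint {u : α → ℝ} (hu : Measurable u) (B : ℝ) (hB : ∀ x, |u x| ≤ B) : Integrable u μ :=
    Integrable.of_bound hu.aestronglyMeasurable B (ae_of_all _ hB)
  have hfj (j : ℕ) : Integrable (fun x => f x * f (τ^[j] x)) μ := by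
    refine hint (hfm.mul (hfm.comp (hτ.measurable.iterate j))) (C * C) fun x => ?_
    rw [abs_mul]
    exact mul_le_mul (hC _) (hC _) (abs_nonneg _) ((abs_nonneg _).trans (hC x))
  induction n with
  | zero => simp
  | succ n ih =>
    have hsq : Integrable (fun x => birkhoffSum τ f n x ^ 2) μ := by
      refine hint ((hSm n).pow_const 2) ((n * C) ^ 2) fun x => ?_
      rw [abs_pow]
      exact pow_le_pow_left₀ (abs_nonneg _) (hSb n x) 2
    have hsqτ : Integrable (fun x => birkhoffSum τ f n (τ x) ^ 2) μ :=
      hτ.integrable_comp_of_integrable hsq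
    have h1 : ∫ x, birkhoffSum τ f n (τ x) ^ 2 ∂μ = ∫ x, birkhoffSum τ f n x ^ 2 ∂μ := by
      rw [← integral_map (f := fun x => birkhoffSum τ f n x ^ 2) hτ.aemeasurable
        (by rw [hτ.map_eq]; exact hsq.1), hτ.map_eq]
    have h2 (x : α) : birkhoffSum τ f (n + 1) x ^ 2
        = f x * f (τ^[0] x) + 2 * ∑ j ∈ Finset.range n, f x * f (τ^[j + 1] x)
          + birkhoffSum τ f n (τ x) ^ 2 := by
      rw [birkhoffSum_succ', ← Finset.mul_sum]
      simp only [birkhoffSum, Function.iterate_succ_apply, Function.iterate_zero, id]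
      ring
    have h3 : ∫ x, birkhoffSum τ f (n + 1) x ^ 2 ∂μ
        = r 0 + 2 * ∑ j ∈ Finset.range n, r (j + 1) + ∫ x, birkhoffSum τ f n x ^ 2 ∂μ := by
      simp_rw [h2]
      have hsum : Integrable
        (fun x => 2 * ∑ j ∈ Finset.range n, f x * f (τ^[j + 1] x)) μ :=
      (integrable_finsetSum _ fun j _ => hfj (j + 1)).const_mul 2
      rw [integral_add (f := fun x => f x * f (τ^[0] x) + 2 * ∑ j ∈ Finset.range n,
        f x * f (τ^[j + 1] x)) ((hfj 0).add hsum) hsqτ, integral_add (hfj 0) hsum,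
        integral_const_mul, integral_finsetSum _ fun j _ => hfj (j + 1), h1]
    have h4 : r 0 + 2 * ∑ j ∈ Finset.range n, r (j + 1)
        ≤ 2 * ∑ j ∈ Finset.range (n + 1), |r j| := by
      rw [Finset.sum_range_succ']
      have := Finset.sum_le_sum fun j (_ : j ∈ Finset.range n) => le_abs_self (r (j + 1))
      linarith [le_abs_self (r 0), abs_nonneg (r 0)]
    have h5 : ∑ j ∈ Finset.range n, |r j| ≤ ∑ j ∈ Finset.range (n + 1), |r j| :=
      Finset.sum_le_sum_of_subset_of_nonneg (by simp) fun _ _ _ => abs_nonneg _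
    rw [h3]
    push_cast
    nlinarith [mul_le_mul_of_nonneg_left h5 (Nat.cast_nonneg (α := ℝ) n)]

/-- By invariance of `D`, the Birkhoff sum has integral `n * m` over `D`, with `m` the integral of
`f` there. Its second moment is `o(n²)`, since Cesàro means of the correlations vanish; so `m = 0`,
although `m` is at least `ε` times the mass of `D`. -/
theorem measure_birkhoffUpperSet_eq_zero [IsProbabilityMeasure μ] (hτ : MeasurePreserving τ μ μ)
    (hfm : Measurable f) {C : ℝ} (hC : ∀ x, |f x| ≤ C)
    (hr : Tendsto (fun n => ∫ x, f x * f (τ^[n] x) ∂μ) atTop (𝓝 0)) {ε : ℝ} (hε : 0 < ε) :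
    μ (birkhoffUpperSet τ f ε) = 0 := by
  set D := birkhoffUpperSet τ f ε with hDdef
  have hD : MeasurableSet D := measurableSet_birkhoffUpperSet hτ.measurable hfm ε
  have hinv : τ ⁻¹' D = D := preimage_birkhoffUpperSet hC ε
  have hf : Integrable f μ := Integrable.of_bound hfm.aestronglyMeasurable C (ae_of_all _ hC)
  set m := ∫ x in D, f x ∂μ with hm
  have hbound (n : ℕ) : (n * m) ^ 2 ≤ ∫ x, birkhoffSum τ f n x ^ 2 ∂μ := by
    have hsq : Integrable (fun x => birkhoffSum τ f n x ^ 2) μ := by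
      refine Integrable.of_bound ((measurable_birkhoffSum hτ.measurable hfm n).pow_const
        2).aestronglyMeasurable ((n * C) ^ 2) (ae_of_all _ fun x => ?_)
      rw [norm_pow]
      refine pow_le_pow_left₀ (norm_nonneg _) ?_ 2
      refine (Finset.abs_sum_le_sum_abs _ _).trans ?_
      simpa using Finset.sum_le_card_nsmul (Finset.range n) (fun i => |f (τ^[i] x)|) C
        fun i _ => hC _
    have hS := integrable_birkhoffSum hτ hf n
    set a := (n : ℝ) * m
    have ha : ∫ x in D, birkhoffSum τ f n x ∂μ = a := setIntegral_birkhoffSum hD hinv hτ hf n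
    -- Cauchy–Schwarz by expanding a square; `D` having mass at most one gives the constant 1.
    have h0 : 0 ≤ ∫ x in D, (birkhoffSum τ f n x - a) ^ 2 ∂μ :=
      integral_nonneg fun x => sq_nonneg _
    have he (x : α) : (birkhoffSum τ f n x - a) ^ 2
        = birkhoffSum τ f n x ^ 2 - 2 * a * birkhoffSum τ f n x + a ^ 2 := by ring
    simp_rw [he] at h0
    rw [integral_add (μ := μ.restrict D)
      (f := fun x => birkhoffSum τ f n x ^ 2 - 2 * a * birkhoffSum τ f n x)
      (hsq.sub (hS.const_mul (2 * a))).restrict (integrable_const _).integrableOn,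
      integral_sub hsq.integrableOn (hS.const_mul _).integrableOn, integral_const_mul, ha,
      setIntegral_const, smul_eq_mul] at h0
    have h1 : ∫ x in D, birkhoffSum τ f n x ^ 2 ∂μ ≤ ∫ x, birkhoffSum τ f n x ^ 2 ∂μ :=
      setIntegral_le_integral hsq (ae_of_all _ fun x => sq_nonneg _)
    have h2 : μ.real D ≤ 1 := measureReal_le_one
    nlinarith [sq_nonneg a]
  have hlim : Tendsto (fun n : ℕ => 2 * ((n : ℝ)⁻¹ *
      ∑ j ∈ Finset.range n, |∫ x, f x * f (τ^[j] x) ∂μ|)) atTop (𝓝 (2 * 0)) :=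
    (by simpa using hr.abs : Tendsto (fun n => |∫ x, f x * f (τ^[n] x) ∂μ|) atTop
      (𝓝 0)).cesaro.const_mul 2
  have hm2 : m ^ 2 ≤ 2 * 0 := by
    refine ge_of_tendsto hlim ((eventually_ge_atTop 1).mono fun n hn => ?_)
    have hn : (0 : ℝ) < n := by exact_mod_cast hn
    have h := (hbound n).trans (integral_sq_birkhoffSum_le hτ hfm hC n)
    rw [← mul_assoc, mul_comm 2, mul_assoc, ← div_eq_inv_mul, le_div_iff₀ hn]
    refine le_of_mul_le_mul_left (a := (n : ℝ)) ?_ hn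
    nlinarith
  have hm0 : m = 0 := by nlinarith [sq_nonneg m]
  have h := mul_measure_birkhoffUpperSet_le hτ hfm hC ε
  rw [← hDdef, ← hm, hm0] at h
  have h' : μ.real D ≤ 0 := by
    by_contra! h'
    nlinarith [mul_pos hε h']
  exact (measureReal_eq_zero_iff).1 (le_antisymm h' measureReal_nonneg)

/-- The pointwise ergodic theorem for a bounded observable whose autocorrelations vanish. -/
theorem ae_tendsto_birkhoffAverage_zero [IsProbabilityMeasure μ] (hτ : MeasurePreserving τ μ μ)
    (hfm : Measurable f) {C : ℝ} (hC : ∀ x, |f x| ≤ C)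
    (hr : Tendsto (fun n => ∫ x, f x * f (τ^[n] x) ∂μ) atTop (𝓝 0)) :
    ∀ᵐ x ∂μ, Tendsto (fun n => birkhoffAverage ℝ τ f n x) atTop (𝓝 0) := by
  have h1 : ∀ᵐ x ∂μ, ∀ m : ℕ, x ∉ birkhoffUpperSet τ f (1 / ((m : ℝ) + 1)) := by
    rw [ae_all_iff]
    intro m
    exact measure_eq_zero_iff_ae_notMem.1
      (measure_birkhoffUpperSet_eq_zero hτ hfm hC hr (by positivity))
  have h2 : ∀ᵐ x ∂μ, ∀ m : ℕ, x ∉ birkhoffUpperSet τ (fun x => -f x) (1 / ((m : ℝ) + 1)) := by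
    rw [ae_all_iff]
    intro m
    exact measure_eq_zero_iff_ae_notMem.1
      (measure_birkhoffUpperSet_eq_zero hτ hfm.neg (C := C) (by simpa using hC) (by simpa using hr)
        (by positivity))
  filter_upwards [h1, h2] with x hx1 hx2
  have hneg (n : ℕ) : birkhoffAverage ℝ τ (fun x => -f x) n x = -birkhoffAverage ℝ τ f n x := by
    simp [birkhoffAverage, birkhoffSum]
  rw [Metric.tendsto_atTop]
  intro ε hε
  obtain ⟨m, hm⟩ := exists_nat_one_div_lt (half_pos hε)
  have e1 := hx1 m
  have e2 := hx2 m
  simp only [birkhoffUpperSet, mem_ofPred_eq, not_exists, not_frequently, not_lt, hneg] at e1 e2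
  obtain ⟨N, hN⟩ := eventually_atTop.1 ((e1 m).and (e2 m))
  refine ⟨N, fun n hn => ?_⟩
  have := hN n hn
  rw [Real.dist_eq, sub_zero, abs_lt]
  constructor <;> linarith [this.1, this.2]

end Ergodic

namespace CBI

/-! ### The flow `v`. -/

section Flow

variable {b c : ℝ}

theorem v_nonneg {t l : ℝ} (hb : 0 < b) (hc : 0 ≤ c) (ht : 0 ≤ t) (hl : 0 ≤ l) :
    0 ≤ v b c t l :=
  div_nonneg (by positivity) (v_denom_pos hb hc ht hl).le

theorem v_pos {t l : ℝ} (hb : 0 < b) (hc : 0 ≤ c) (ht : 0 ≤ t) (hl : 0 < l) :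
    0 < v b c t l :=
  div_pos (by positivity) (v_denom_pos hb hc ht hl.le)

theorem one_sub_exp_neg_mul_nonneg {x y : ℝ} (hx : 0 ≤ x) (hy : 0 ≤ y) :
    0 ≤ 1 - Real.exp (-x * y) :=
  sub_nonneg.2 (Real.exp_le_one_iff.2 (by nlinarith))

theorem v_le_exp_mul {t l : ℝ} (hb : 0 < b) (hc : 0 ≤ c) (ht : 0 ≤ t) (hl : 0 ≤ l) :
    v b c t l ≤ Real.exp (-b * t) * l := by
  refine div_le_self (by positivity) ?_
  have := mul_nonneg (show 0 ≤ c * l / b by positivity) (one_sub_exp_neg_mul_nonneg hb.le ht)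
  linarith

theorem v_add {s t l : ℝ} (hb : 0 < b) (hc : 0 ≤ c) (hs : 0 ≤ s) (ht : 0 ≤ t) (hl : 0 ≤ l) :
    v b c (s + t) l = v b c s (v b c t l) := by
  have h1 := (v_denom_pos hb hc ht hl).ne'
  have h2 := (v_denom_pos hb hc (add_nonneg hs ht) hl).ne'
  have h3 := (v_denom_pos hb hc hs (v_nonneg hb hc ht hl)).ne'
  have he : Real.exp (-b * (s + t)) = Real.exp (-b * s) * Real.exp (-b * t) := by
    rw [← Real.exp_add]; ring_nf
  have h4 : v b c t l * (1 + c * l / b * (1 - Real.exp (-b * t))) = Real.exp (-b * t) * l :=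
    div_mul_cancel₀ _ h1
  -- The extra factor is the denominator of the inner value `v b c t l`, which `h4` then eliminates.
  rw [v, v, div_eq_div_iff h2 h3, he, ← mul_left_inj' h1]
  generalize v b c t l = y at *
  generalize Real.exp (-b * s) = E at *
  generalize Real.exp (-b * t) = F at *
  linear_combination (F * E * l * (c / b) * (1 - E) - E * (1 + c * l / b * (1 - E * F))) * h4

theorem v_mono {t l l' : ℝ} (hb : 0 < b) (hc : 0 ≤ c) (ht : 0 ≤ t) (hl : 0 ≤ l) (h : l ≤ l') :
    v b c t l ≤ v b c t l' := by
  have hb' := hb.ne'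
  rw [v, v, div_le_div_iff₀ (v_denom_pos hb hc ht hl) (v_denom_pos hb hc ht (hl.trans h))]
  have : Real.exp (-b * t) * l' * (1 + c * l / b * (1 - Real.exp (-b * t)))
      - Real.exp (-b * t) * l * (1 + c * l' / b * (1 - Real.exp (-b * t)))
      = Real.exp (-b * t) * (l' - l) := by
    field_simp
    ring
  nlinarith [mul_nonneg (Real.exp_pos (-b * t)).le (sub_nonneg.2 h)]

theorem v_lt_of_lt {s t l : ℝ} (hb : 0 < b) (hc : 0 ≤ c) (hs : 0 ≤ s) (hst : s < t) (hl : 0 < l) :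
    v b c t l < v b c s l := by
  have h := v_add hb hc (sub_pos.2 hst).le hs hl.le
  rw [sub_add_cancel] at h
  have hp := v_pos hb hc hs hl
  calc v b c t l ≤ Real.exp (-b * (t - s)) * v b c s l :=
        h ▸ v_le_exp_mul hb hc (sub_pos.2 hst).le hp.le
    _ < 1 * v b c s l := by
        refine mul_lt_mul_of_pos_right (Real.exp_lt_one_iff.2 ?_) hp
        nlinarith
    _ = _ := one_mul _

theorem continuousOn_v {l : ℝ} (hb : 0 < b) (hc : 0 ≤ c) (hl : 0 ≤ l) :
    ContinuousOn (fun t => v b c t l) (Ici 0) := fun _ ht =>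
  (v_hasDerivAt hb hc ht hl).continuousAt.continuousWithinAt

theorem mapsTo_v {l : ℝ} (hb : 0 < b) (hc : 0 ≤ c) (hl : 0 ≤ l) :
    MapsTo (fun t => v b c t l) (Ici 0) (Ici 0) := fun _ ht => v_nonneg hb hc ht hl

theorem tendsto_v_atTop {l : ℝ} (hb : 0 < b) (hc : 0 ≤ c) (hl : 0 ≤ l) :
    Tendsto (fun t => v b c t l) atTop (𝓝 0) := by
  have h : Tendsto (fun t : ℝ => Real.exp (-b * t) * l) atTop (𝓝 (0 * l)) := by
    refine Tendsto.mul_const _ (Real.tendsto_exp_atBot.comp ?_)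
    exact tendsto_id.const_mul_atTop_of_neg (neg_lt_zero.2 hb)
  rw [zero_mul] at h
  refine tendsto_of_tendsto_of_tendsto_of_le_of_le' tendsto_const_nhds h
    ((eventually_ge_atTop 0).mono fun t ht => v_nonneg hb hc ht hl)
    ((eventually_ge_atTop 0).mono fun t ht => v_le_exp_mul hb hc ht hl)

theorem integrableOn_v {l : ℝ} (hb : 0 < b) (hc : 0 ≤ c) (hl : 0 ≤ l) :
    IntegrableOn (fun t => v b c t l) (Ioi 0) := by
  refine Integrable.mono' (g := fun t => Real.exp (-b * t) * l)
    ((exp_neg_integrableOn_Ioi 0 hb).mul_const l)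
    (((continuousOn_v hb hc hl).mono Ioi_subset_Ici_self).aestronglyMeasurable measurableSet_Ioi)
    ((ae_restrict_iff' measurableSet_Ioi).2 (ae_of_all _ fun t ht => ?_))
  have ht : 0 ≤ t := le_of_lt ht
  rw [Real.norm_of_nonneg (v_nonneg hb hc ht hl)]
  exact v_le_exp_mul hb hc ht hl

end Flow

/-! ### Regularity of the immigration mechanism. -/

section Psi

variable {β b c : ℝ} {k : ℝ → ℝ}

/-- `k` belongs to `L¹(μ)`, where `μ(dz) = (z ∧ 1) dz` on `(0, ∞)`. -/
def IntegrableMu (k : ℝ → ℝ) : Prop := IntegrableOn (fun u => k u * min u 1) (Ioi 0)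

/-- This compares the integrand of `psi` with the density of `μ`; it is why `L¹(μ)` is the natural
space of Lévy densities. -/
theorem one_sub_exp_le (z : ℝ) {u : ℝ} (hu : 0 < u) :
    1 - Real.exp (-z * u) ≤ max 1 z * min u 1 := by
  have h1 := Real.add_one_le_exp (-z * u)
  rcases le_total u 1 with h | h
  · rw [min_eq_left h]
    nlinarith [le_max_right 1 z]
  · rw [min_eq_right h]
    linarith [le_max_left 1 z, Real.exp_pos (-z * u)]

theorem norm_one_sub_exp_mul_le {z u : ℝ} (hz : 0 ≤ z) (hu : 0 < u) (x : ℝ) :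
    ‖(1 - Real.exp (-z * u)) * x‖ ≤ max 1 z * ‖x * min u 1‖ := by
  have hm : 0 ≤ min u 1 := le_min hu.le zero_le_one
  rw [norm_mul, norm_mul, Real.norm_of_nonneg (one_sub_exp_neg_mul_nonneg hz hu.le),
    Real.norm_of_nonneg hm]
  nlinarith [mul_le_mul_of_nonneg_right (one_sub_exp_le z hu) (norm_nonneg x)]

theorem IntegrableMu.aestronglyMeasurable (hk : IntegrableMu k) :
    AEStronglyMeasurable k (volume.restrict (Ioi 0)) := by
  have h : AEStronglyMeasurable (fun u => k u * min u 1 * (min u 1)⁻¹)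
      (volume.restrict (Ioi (0 : ℝ))) :=
    hk.1.mul (by fun_prop : Measurable fun u : ℝ => (min u 1)⁻¹).aestronglyMeasurable
  refine h.congr ((ae_restrict_iff' measurableSet_Ioi).2 (ae_of_all _ fun u hu => ?_))
  have : min u 1 ≠ 0 := (lt_min hu one_pos).ne'
  field_simp

theorem aestronglyMeasurable_one_sub_exp_mul (hk : IntegrableMu k) (z : ℝ) :
    AEStronglyMeasurable (fun u => (1 - Real.exp (-z * u)) * k u) (volume.restrict (Ioi 0)) :=
  (by fun_prop : Continuous fun u : ℝ => 1 - Real.exp (-z * u)).aestronglyMeasurable.mul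
    hk.aestronglyMeasurable

theorem integrableOn_one_sub_exp_mul (hk : IntegrableMu k) {z : ℝ} (hz : 0 ≤ z) :
    IntegrableOn (fun u => (1 - Real.exp (-z * u)) * k u) (Ioi 0) :=
  Integrable.mono' (Integrable.norm hk |>.const_mul (max 1 z))
    (aestronglyMeasurable_one_sub_exp_mul hk z)
    ((ae_restrict_iff' measurableSet_Ioi).2 (ae_of_all _ fun _ hu =>
      norm_one_sub_exp_mul_le hz hu _))

theorem continuousOn_psi (hk : IntegrableMu k) (β : ℝ) : ContinuousOn (psi β k) (Ici 0) := by
  unfold psi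
  refine (continuous_const.mul continuous_id).continuousOn.add fun z _ => ?_
  refine continuousWithinAt_of_dominated
    (bound := fun u => max 1 (z + 1) * ‖k u * min u 1‖)
    (Eventually.of_forall fun z => aestronglyMeasurable_one_sub_exp_mul hk z) ?_
    (Integrable.norm hk |>.const_mul _) (ae_of_all _ fun u => ?_)
  · have h1 : ∀ᶠ y in 𝓝[Ici 0] z, y < z + 1 :=
      nhdsWithin_le_nhds (gt_mem_nhds (lt_add_one z))
    filter_upwards [h1, self_mem_nhdsWithin] with y hy hy0
    refine (ae_restrict_iff' measurableSet_Ioi).2 (ae_of_all _ fun u hu => ?_)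
    refine (norm_one_sub_exp_mul_le hy0 hu _).trans ?_
    gcongr
  · exact Continuous.continuousWithinAt (by fun_prop)

theorem psi_mono (hβ : 0 ≤ β) (hk : IntegrableMu k) (h0 : ∀ z, 0 < z → 0 ≤ k z) {x y : ℝ}
    (hx : 0 ≤ x) (h : x ≤ y) : psi β k x ≤ psi β k y := by
  unfold psi
  refine add_le_add (mul_le_mul_of_nonneg_left h hβ) ?_
  refine setIntegral_mono_on (integrableOn_one_sub_exp_mul hk hx)
    (integrableOn_one_sub_exp_mul hk (hx.trans h)) measurableSet_Ioi fun u hu => ?_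
  refine mul_le_mul_of_nonneg_right (sub_le_sub_left (Real.exp_le_exp.2 ?_) _) (h0 u hu)
  have hu : 0 < u := hu
  nlinarith

theorem psi_nonneg (hβ : 0 ≤ β) (hk : IntegrableMu k) (h0 : ∀ z, 0 < z → 0 ≤ k z) {x : ℝ}
    (hx : 0 ≤ x) : 0 ≤ psi β k x := by
  simpa [psi] using psi_mono hβ hk h0 le_rfl hx

theorem continuousOn_psi_v {l : ℝ} (hb : 0 < b) (hc : 0 ≤ c) (hk : IntegrableMu k) (β : ℝ)
    (hl : 0 ≤ l) : ContinuousOn (fun s => psi β k (v b c s l)) (Ici 0) :=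
  (continuousOn_psi hk β).comp (continuousOn_v hb hc hl) (mapsTo_v hb hc hl)

theorem intervalIntegrable_psi_v {l t : ℝ} (hb : 0 < b) (hc : 0 ≤ c) (hk : IntegrableMu k) (β : ℝ)
    (hl : 0 ≤ l) (ht : 0 ≤ t) :
    IntervalIntegrable (fun s => psi β k (v b c s l)) volume 0 t :=
  ((continuousOn_psi_v hb hc hk β hl).mono (by
    rw [uIcc_of_le ht]; exact Icc_subset_Ici_self)).intervalIntegrable

theorem aemeasurable_of_locallyBoundedVariationOn {f : ℝ → ℝ} {s : Set ℝ} (hs : MeasurableSet s)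
    (hf : LocallyBoundedVariationOn f s) : AEMeasurable f (volume.restrict s) := by
  obtain ⟨p, q, hp, hq, rfl⟩ := hf.exists_monotoneOn_sub_monotoneOn
  exact (aemeasurable_restrict_of_monotoneOn hs hp).sub (aemeasurable_restrict_of_monotoneOn hs hq)

theorem IsInK.integrableMu (hk : IsInK k) : IntegrableMu k := by
  have hm := aemeasurable_of_locallyBoundedVariationOn measurableSet_Ioi hk.locallyBV
  refine ⟨(hm.mul (by fun_prop : Measurable fun u : ℝ => min u 1).aemeasurable).aestronglyMeasurable,
    lt_of_le_of_lt ?_ hk.integrable⟩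
  refine setLIntegral_mono' measurableSet_Ioi fun u hu => ?_
  have hu' : 0 ≤ min u 1 := le_min (le_of_lt hu) zero_le_one
  rw [← ofReal_norm, norm_mul, Real.norm_of_nonneg hu']
  simp

end Psi

/-! ### `T` as an integral of `psi` along the flow. -/

section LaplaceExponent

variable {β b c : ℝ} {k : ℝ → ℝ}

theorem lintegral_one_sub_exp_mul (hk : IntegrableMu k) (h0 : ∀ z, 0 < z → 0 ≤ k z) {x : ℝ}
    (hx : 0 ≤ x) : ∫⁻ z in Ioi (0 : ℝ), ENNReal.ofReal ((1 - Real.exp (-z * x)) * k z)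
      = ENNReal.ofReal (psi 0 k x) := by
  have hcomm (z : ℝ) : -z * x = -x * z := by ring
  simp_rw [hcomm]
  rw [psi, zero_mul, zero_add, ofReal_integral_eq_lintegral_ofReal
    (integrableOn_one_sub_exp_mul hk hx)]
  exact (ae_restrict_iff' measurableSet_Ioi).2 (ae_of_all _ fun u hu =>
    mul_nonneg (one_sub_exp_neg_mul_nonneg hx (le_of_lt hu)) (h0 u hu))

theorem psi_eq_add (β : ℝ) (k : ℝ → ℝ) (z : ℝ) : psi β k z = β * z + psi 0 k z := by
  simp [psi]

/-- The inner integral is the driftless `psi`. A drift adds a multiple of `v`, which is integrable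
by its exponential decay, so `β` is immaterial. -/
theorem tFinite_iff (hb : 0 < b) (hc : 0 ≤ c) (hk : IntegrableMu k)
    (h0 : ∀ z, 0 < z → 0 ≤ k z) :
    TFinite b c k ↔ ∀ l, 0 < l → IntegrableOn (fun s => psi β k (v b c s l)) (Ioi 0) := by
  refine forall₂_congr fun l hl => ?_
  have h1 : ∫⁻ s in Ioi (0 : ℝ), ∫⁻ z in Ioi (0 : ℝ),
      ENNReal.ofReal ((1 - Real.exp (-z * v b c s l)) * k z)
      = ∫⁻ s in Ioi (0 : ℝ), ENNReal.ofReal (psi 0 k (v b c s l)) :=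
    setLIntegral_congr_fun measurableSet_Ioi fun s hs =>
      lintegral_one_sub_exp_mul hk h0 (v_nonneg hb hc (le_of_lt hs) hl.le)
  have hm : AEStronglyMeasurable (fun s => psi 0 k (v b c s l)) (volume.restrict (Ioi 0)) :=
    ((continuousOn_psi_v hb hc hk 0 hl.le).mono Ioi_subset_Ici_self).aestronglyMeasurable
      measurableSet_Ioi
  have hnn : 0 ≤ᵐ[volume.restrict (Ioi 0)] fun s => psi 0 k (v b c s l) :=
    (ae_restrict_iff' measurableSet_Ioi).2 (ae_of_all _ fun s hs =>
      psi_nonneg le_rfl hk h0 (v_nonneg hb hc (le_of_lt hs) hl.le))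
  have hv := (integrableOn_v hb hc hl.le).const_mul β
  rw [h1, ← hasFiniteIntegral_iff_ofReal hnn]
  simp_rw [psi_eq_add β]
  constructor
  · exact fun h => Integrable.add hv ⟨hm, h⟩
  · intro h
    have := Integrable.sub h hv
    simpa using (this.congr (ae_of_all _ fun s => by simp) :
      Integrable (fun s => psi 0 k (v b c s l)) (volume.restrict (Ioi 0))).2

theorem T_eq (hb : 0 < b) (hc : 0 ≤ c) (hk : IntegrableMu k)
    (h0 : ∀ z, 0 < z → 0 ≤ k z) (hT : TFinite b c k) {l : ℝ} (hl : 0 < l) :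
    T β b c k l = -∫ s in Ioi (0 : ℝ), psi β k (v b c s l) := by
  have hcomm (s z : ℝ) : -z * v b c s l = -v b c s l * z := by ring
  have h1 := (tFinite_iff (β := 0) hb hc hk h0).1 hT l hl
  have h2 := (integrableOn_v hb hc hl.le).const_mul β
  simp_rw [psi_eq_add β]
  rw [integral_add h2 h1, integral_const_mul, T]
  simp_rw [hcomm]
  simp only [psi, zero_mul, zero_add]
  ring

/-- The semiflow property shifts the time integral by `t`. Comparing two points of one orbit thus
cancels the infinite tail, the only part of `T` not controlled by the envelope. -/
theorem T_v (hb : 0 < b) (hc : 0 ≤ c) (hk : IntegrableMu k)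
    (h0 : ∀ z, 0 < z → 0 ≤ k z) (hT : TFinite b c k) {l t : ℝ} (hl : 0 < l) (ht : 0 ≤ t) :
    T β b c k (v b c t l) = T β b c k l + ∫ s in (0 : ℝ)..t, psi β k (v b c s l) := by
  have hi := (tFinite_iff (β := β) hb hc hk h0).1 hT l hl
  rw [T_eq hb hc hk h0 hT hl, T_eq hb hc hk h0 hT (v_pos hb hc ht hl)]
  have h1 : ∫ s in Ioi (0 : ℝ), psi β k (v b c s (v b c t l))
      = ∫ s in Ioi t, psi β k (v b c s l) := by
    rw [← (measurePreserving_add_right volume t).setIntegral_preimage_emb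
      (measurableEmbedding_addRight t) (fun s => psi β k (v b c s l)), preimage_add_const_Ioi, sub_self]
    exact setIntegral_congr_fun measurableSet_Ioi fun s hs => by
      simp only [v_add hb hc (le_of_lt hs) ht hl.le]
  have h2 := intervalIntegral.integral_interval_add_Ioi hi (hi.mono_set (Ioi_subset_Ioi ht))
  rw [h1]
  linarith

theorem antitoneOn_T (hβ : 0 ≤ β) (hb : 0 < b) (hc : 0 ≤ c) (hk : IntegrableMu k)
    (h0 : ∀ z, 0 < z → 0 ≤ k z) (hT : TFinite b c k) : AntitoneOn (T β b c k) (Ioi 0) := by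
  intro x hx y hy h
  have hx : 0 < x := hx
  have hy : 0 < y := hy
  have hi := (tFinite_iff (β := β) hb hc hk h0).1 hT
  rw [T_eq hb hc hk h0 hT hx, T_eq hb hc hk h0 hT hy, neg_le_neg_iff]
  exact setIntegral_mono_on (hi x hx) (hi y hy) measurableSet_Ioi fun s hs =>
    psi_mono hβ hk h0 (v_nonneg hb hc (le_of_lt hs) hx.le) (v_mono hb hc (le_of_lt hs) hx.le h)

end LaplaceExponent

/-! ### Stationary law, decorrelation and law of large numbers. -/

section StationaryCBI

variable {Ω : Type*} [MeasurableSpace Ω] {P : Measure Ω} [IsProbabilityMeasure P]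
  {β b c : ℝ} {k : ℝ → ℝ} {X : ℝ≥0 → Ω → ℝ≥0}

/-- The Laplace transform of a random variable. -/
noncomputable def laplace (P : Measure Ω) (Y : Ω → ℝ≥0) (l : ℝ) : ℝ :=
  ∫ ω, Real.exp (-l * (Y ω : ℝ)) ∂P

theorem abs_exp_neg_mul_le {l : ℝ} (hl : 0 ≤ l) (x : ℝ≥0) : |Real.exp (-l * (x : ℝ))| ≤ 1 := by
  rw [Real.abs_exp, Real.exp_le_one_iff]
  nlinarith [x.2, mul_nonneg hl x.2]

theorem measurable_exp_neg_mul (l : ℝ) : Measurable fun x : ℝ≥0 => Real.exp (-l * (x : ℝ)) := by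
  fun_prop

omit [IsProbabilityMeasure P] in
theorem integrable_of_abs_le [IsFiniteMeasure P] {f : Ω → ℝ} (hf : Measurable f) {C : ℝ}
    (hC : ∀ ω, |f ω| ≤ C) : Integrable f P :=
  Integrable.of_bound hf.aestronglyMeasurable C (ae_of_all _ hC)

theorem integrable_exp_neg_mul {Y : Ω → ℝ≥0} (hY : Measurable Y) {l : ℝ} (hl : 0 ≤ l) :
    Integrable (fun ω => Real.exp (-l * (Y ω : ℝ))) P :=
  integrable_of_abs_le ((measurable_exp_neg_mul l).comp hY) fun ω => abs_exp_neg_mul_le hl (Y ω)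

theorem laplace_pos {Y : Ω → ℝ≥0} (hY : Measurable Y) {l : ℝ} (hl : 0 ≤ l) : 0 < laplace P Y l :=
  integral_exp_pos (integrable_exp_neg_mul hY hl)

theorem laplace_le_one {Y : Ω → ℝ≥0} (hY : Measurable Y) {l : ℝ} (hl : 0 ≤ l) :
    laplace P Y l ≤ 1 := by
  have := integral_mono (integrable_exp_neg_mul (P := P) hY hl) (integrable_const 1)
    fun ω => (le_abs_self _).trans (abs_exp_neg_mul_le hl (Y ω))
  simpa [laplace] using this

theorem tendsto_laplace_zero {Y : Ω → ℝ≥0} (hY : Measurable Y) {ι : Type*} {u : Filter ι}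
    [u.IsCountablyGenerated] {x : ι → ℝ} (hx : Tendsto x u (𝓝 0)) (h0 : ∀ᶠ i in u, 0 ≤ x i) :
    Tendsto (fun i => laplace P Y (x i)) u (𝓝 1) := by
  have h : Tendsto (fun i => laplace P Y (x i)) u (𝓝 (∫ ω, (1 : ℝ) ∂P)) := by
    refine tendsto_integral_filter_of_dominated_convergence (fun _ => 1)
      (Eventually.of_forall fun i =>
        ((measurable_exp_neg_mul (x i)).comp hY).aestronglyMeasurable)
      (h0.mono fun i hi => ae_of_all _ fun ω => abs_exp_neg_mul_le hi (Y ω))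
      (integrable_const _) (ae_of_all _ fun ω => ?_)
    have : Tendsto (fun i => Real.exp (-x i * (Y ω : ℝ))) u (𝓝 (Real.exp (-0 * (Y ω : ℝ)))) :=
      (Real.continuous_exp.tendsto _).comp (hx.neg.mul_const _)
    simpa using this
  simpa using h

/-- The exponent `∫₀ᵗ ψ(v_s(l)) ds` of the transition semigroup. -/
noncomputable def immigration (β b c : ℝ) (k : ℝ → ℝ) (l t : ℝ) : ℝ :=
  ∫ s in (0 : ℝ)..t, psi β k (v b c s l)

/-- The Laplace transform of the transition kernel, integrated against the initial state. -/
theorem integral_mul_exp_neg_eq (hX : IsCBIProcess P β b c k X) {F : ℝ≥0 → ℝ} (hF : Measurable F)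
    {C : ℝ} (hC : ∀ x, |F x| ≤ C) (t : ℝ≥0) {l : ℝ} (hl : 0 ≤ l) :
    ∫ ω, F (X 0 ω) * Real.exp (-l * (X t ω : ℝ)) ∂P
      = ∫ ω, F (X 0 ω) *
          Real.exp (-(X 0 ω : ℝ) * v b c t l - immigration β b c k l t) ∂P := by
  obtain ⟨hXm, κ, hκ, hM⟩ := hX
  have hMarkov : IsMarkovKernel (κ t) := ⟨fun x => (hκ t x).1⟩
  -- The Markov property at time 0, tested on rectangles, identifies the joint law of `X 0` and `X
  -- t`.
  have hlaw : P.map (fun ω => (X 0 ω, X t ω)) = (P.map (X 0)) ⊗ₘ κ t := by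
    refine Measure.ext_prod fun {A B} hA hB => ?_
    have hmX : Measurable fun ω => (X 0 ω, X t ω) := (hXm 0).prodMk (hXm t)
    have : IsProbabilityMeasure (P.map (X 0)) :=
      Measure.isProbabilityMeasure_map (hXm 0).aemeasurable
    rw [Measure.map_apply hmX (hA.prod hB), Measure.compProd_apply_prod hA hB,
      setLIntegral_map hA ((κ t).measurable_coe hB) (hXm 0)]
    have hmle : (⨆ u : {u : ℝ≥0 // u ≤ 0}, MeasurableSpace.comap (X u) inferInstance)
        ≤ ‹MeasurableSpace Ω› := iSup_le fun u => (hXm u).comap_le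
    have hAm : MeasurableSet[⨆ u : {u : ℝ≥0 // u ≤ 0}, MeasurableSpace.comap (X u) inferInstance]
        (X 0 ⁻¹' A) :=
      le_iSup (fun u : {u : ℝ≥0 // u ≤ 0} =>
        MeasurableSpace.comap (X u) (inferInstance : MeasurableSpace ℝ≥0)) ⟨0, le_rfl⟩ _
        ⟨A, hA, rfl⟩
    have h1 := hM 0 t B hB
    rw [zero_add] at h1
    have hBi : Integrable ((X t ⁻¹' B).indicator fun _ => (1 : ℝ)) P :=
      (integrable_const 1).indicator (hXm t hB)
    have h2 := setIntegral_condExp hmle hBi hAm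
    rw [setIntegral_congr_ae (g := fun ω => (κ t (X 0 ω)).real B) (hXm 0 hA)
      (h1.mono fun ω h _ => h), setIntegral_indicator (hXm t hB), setIntegral_const, smul_eq_mul,
      mul_one] at h2
    have h3 : Integrable (fun ω => (κ t (X 0 ω)).real B) P :=
      integrable_of_abs_le (((κ t).measurable_coe hB).ennreal_toReal.comp (hXm 0)) (C := 1)
        fun ω => by rw [abs_of_nonneg measureReal_nonneg]; exact measureReal_le_one
    rw [mk_preimage_prod, ← ENNReal.ofReal_toReal (measure_ne_top P _)]
    change ENNReal.ofReal (P.real _) = _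
    rw [← h2, ofReal_integral_eq_lintegral_ofReal h3.integrableOn
      (ae_of_all _ fun ω => measureReal_nonneg)]
    simp [measureReal_def, ENNReal.ofReal_toReal]
  have hG := measurable_exp_neg_mul l
  have hprod : Measurable fun p : ℝ≥0 × ℝ≥0 => F p.1 * Real.exp (-l * (p.2 : ℝ)) := by fun_prop
  have : IsProbabilityMeasure (P.map (X 0)) :=
    Measure.isProbabilityMeasure_map (hXm 0).aemeasurable
  have hint : Integrable (fun p : ℝ≥0 × ℝ≥0 => F p.1 * Real.exp (-l * (p.2 : ℝ)))
      ((P.map (X 0)) ⊗ₘ κ t) := by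
    refine integrable_of_abs_le hprod (C := C * 1) fun p => ?_
    rw [abs_mul]
    exact mul_le_mul (hC _) (abs_exp_neg_mul_le hl _) (abs_nonneg _)
      ((abs_nonneg _).trans (hC p.1))
  calc ∫ ω, F (X 0 ω) * Real.exp (-l * (X t ω : ℝ)) ∂P
      = ∫ p, F p.1 * Real.exp (-l * (p.2 : ℝ)) ∂(P.map fun ω => (X 0 ω, X t ω)) :=
        (integral_map ((hXm 0).prodMk (hXm t)).aemeasurable hprod.aestronglyMeasurable).symm
    _ = ∫ x, F x * Real.exp (-(x : ℝ) * v b c t l - immigration β b c k l t) ∂(P.map (X 0)) := by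
        rw [hlaw, Measure.integral_compProd hint]
        simp_rw [integral_const_mul, (hκ t _).2 l hl]
        rfl
    _ = _ := integral_map (hXm 0).aemeasurable
        (by fun_prop : Measurable _).aestronglyMeasurable

omit [IsProbabilityMeasure P] in
theorem IsStationaryProcess.integral_comp (hS : IsStationaryProcess P X)
    {F : (ℝ≥0 → ℝ≥0) → ℝ} (hF : Measurable F) (h : ℝ≥0) :
    ∫ ω, F (fun t => X (t + h) ω) ∂P = ∫ ω, F (fun t => X t ω) ∂P :=
  ((hS h).comp hF).integral_eq

theorem laplace_eq_mul (hX : IsCBIProcess P β b c k X) (hS : IsStationaryProcess P X) (t : ℝ≥0)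
    {l : ℝ} (hl : 0 ≤ l) :
    laplace P (X 0) l = laplace P (X 0) (v b c t l) * Real.exp (-immigration β b c k l t) := by
  have h1 := integral_mul_exp_neg_eq hX (F := fun _ => 1) measurable_const (C := 1) (by simp) t hl
  simp only [one_mul] at h1
  have h2 := hS.integral_comp (F := fun y => Real.exp (-l * (y 0 : ℝ)))
    ((measurable_exp_neg_mul l).comp (measurable_pi_apply 0)) t
  simp only [zero_add] at h2
  rw [laplace, ← h2, h1, laplace, ← integral_mul_const]
  refine integral_congr_ae (ae_of_all _ fun ω => ?_)
  simp only
  rw [← Real.exp_add]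
  ring_nf

theorem immigration_eq (hb : 0 < b) (hc : 0 ≤ c) (hX : IsCBIProcess P β b c k X)
    (hS : IsStationaryProcess P X) {t : ℝ} (ht : 0 ≤ t) {l : ℝ} (hl : 0 ≤ l) :
    immigration β b c k l t
      = Real.log (laplace P (X 0) (v b c t l)) - Real.log (laplace P (X 0) l) := by
  have h := laplace_eq_mul hX hS ⟨t, ht⟩ hl
  change _ = laplace P (X 0) (v b c t l) * Real.exp (-immigration β b c k l t) at h
  rw [h, Real.log_mul (laplace_pos (hX.1 0) (v_nonneg hb hc ht hl)).ne' (Real.exp_pos _).ne',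
    Real.log_exp]
  ring

/-- Since `v_t(l) → 0`, the factor `L(v_t(l))` in the stationarity equation tends to 1. -/
theorem tendsto_immigration (hb : 0 < b) (hc : 0 ≤ c) (hX : IsCBIProcess P β b c k X)
    (hS : IsStationaryProcess P X) {l : ℝ} (hl : 0 ≤ l) :
    Tendsto (immigration β b c k l) atTop (𝓝 (-Real.log (laplace P (X 0) l))) := by
  have h1 : Tendsto (fun t => laplace P (X 0) (v b c t l)) atTop (𝓝 1) :=
    tendsto_laplace_zero (hX.1 0) (tendsto_v_atTop hb hc hl)
      ((eventually_ge_atTop 0).mono fun t ht => v_nonneg hb hc ht hl)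
  have h2 := (h1.log one_ne_zero).sub_const (Real.log (laplace P (X 0) l))
  rw [Real.log_one, zero_sub] at h2
  exact h2.congr' ((eventually_ge_atTop 0).mono fun t ht => (immigration_eq hb hc hX hS ht hl).symm)

/-- Stationarity forces `∫₀^∞ ψ(v_s(l)) ds` to be finite. -/
theorem integrableOn_psi_v (hβ : 0 ≤ β) (hb : 0 < b) (hc : 0 ≤ c) (hk : IntegrableMu k)
    (h0 : ∀ z, 0 < z → 0 ≤ k z) (hX : IsCBIProcess P β b c k X)
    (hS : IsStationaryProcess P X) {l : ℝ} (hl : 0 < l) :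
    IntegrableOn (fun s => psi β k (v b c s l)) (Ioi 0) := by
  refine integrableOn_Ioi_of_intervalIntegral_norm_bounded (l := atTop) (b := fun n : ℕ => (n : ℝ))
    (-Real.log (laplace P (X 0) l)) 0 (fun n => ?_) tendsto_natCast_atTop_atTop
    (Eventually.of_forall fun n => ?_)
  · exact (intervalIntegrable_psi_v hb hc hk β hl.le n.cast_nonneg).1
  · have hn : (0 : ℝ) ≤ n := n.cast_nonneg
    have h1 : ∫ s in (0 : ℝ)..n, ‖psi β k (v b c s l)‖ = immigration β b c k l n := by
      refine intervalIntegral.integral_congr fun s hs => ?_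
      rw [uIcc_of_le hn] at hs
      exact Real.norm_of_nonneg (psi_nonneg hβ hk h0 (v_nonneg hb hc hs.1 hl.le))
    rw [h1, immigration_eq hb hc hX hS hn hl.le]
    have h2 := Real.log_nonpos (laplace_pos (P := P) (hX.1 0) (v_nonneg hb hc hn hl.le)).le
      (laplace_le_one (hX.1 0) (v_nonneg hb hc hn hl.le))
    linarith

theorem tFinite_of_stationary (hβ : 0 ≤ β) (hb : 0 < b) (hc : 0 ≤ c) (hk : IntegrableMu k)
    (h0 : ∀ z, 0 < z → 0 ≤ k z) (hX : IsCBIProcess P β b c k X)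
    (hS : IsStationaryProcess P X) : TFinite b c k :=
  (tFinite_iff hb hc hk h0).2 fun _ hl => integrableOn_psi_v hβ hb hc hk h0 hX hS hl

theorem T_eq_log_laplace (hβ : 0 ≤ β) (hb : 0 < b) (hc : 0 ≤ c) (hk : IntegrableMu k)
    (h0 : ∀ z, 0 < z → 0 ≤ k z) (hX : IsCBIProcess P β b c k X)
    (hS : IsStationaryProcess P X) {l : ℝ} (hl : 0 < l) :
    T β b c k l = Real.log (laplace P (X 0) l) := by
  rw [T_eq hb hc hk h0 (tFinite_of_stationary hβ hb hc hk h0 hX hS) hl]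
  have h1 := intervalIntegral_tendsto_integral_Ioi 0
    (integrableOn_psi_v hβ hb hc hk h0 hX hS hl) tendsto_id
  rw [tendsto_nhds_unique h1 (tendsto_immigration hb hc hX hS hl.le), neg_neg]

/-- The autocovariances of `exp (-l X)` vanish at infinity. -/
theorem tendsto_autocovariance (hb : 0 < b) (hc : 0 ≤ c) (hX : IsCBIProcess P β b c k X)
    (hS : IsStationaryProcess P X) {l : ℝ} (hl : 0 ≤ l) :
    Tendsto (fun n : ℕ => ∫ ω, (Real.exp (-l * (X 0 ω : ℝ)) - laplace P (X 0) l)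
      * (Real.exp (-l * (X n ω : ℝ)) - laplace P (X 0) l) ∂P) atTop (𝓝 0) := by
  set L := laplace P (X 0) l with hL
  have hL0 : 0 < L := laplace_pos (hX.1 0) hl
  have hL1 : L ≤ 1 := laplace_le_one (hX.1 0) hl
  set F : ℝ≥0 → ℝ := fun x => Real.exp (-l * (x : ℝ)) - L with hFdef
  have hFm : Measurable F := (measurable_exp_neg_mul l).sub_const L
  have hFb (x : ℝ≥0) : |F x| ≤ 1 := by
    have h1 := Real.exp_pos (-l * (x : ℝ))
    have h2 := (le_abs_self _).trans (abs_exp_neg_mul_le hl x)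
    rw [abs_le]
    constructor <;> simp only [hFdef] <;> linarith
  have hFX : Integrable (fun ω => F (X 0 ω)) P :=
    integrable_of_abs_le (hFm.comp (hX.1 0)) fun ω => hFb _
  have hF0 : ∫ ω, F (X 0 ω) ∂P = 0 := by
    simp only [hFdef]
    rw [integral_sub (integrable_exp_neg_mul (hX.1 0) hl) (integrable_const _)]
    simp [hL, laplace]
  have he (n : ℕ) : ∫ ω, F (X 0 ω) * F (X n ω) ∂P = ∫ ω, F (X 0 ω) *
      Real.exp (-(X 0 ω : ℝ) * v b c n l - immigration β b c k l n) ∂P := by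
    have h := integral_mul_exp_neg_eq hX hFm hFb n hl
    have hi : Integrable (fun ω => F (X 0 ω) * Real.exp (-l * (X n ω : ℝ))) P := by
      refine integrable_of_abs_le ((hFm.comp (hX.1 0)).mul
        ((measurable_exp_neg_mul l).comp (hX.1 n))) (C := 1 * 1) fun ω => ?_
      rw [abs_mul]
      exact mul_le_mul (hFb _) (abs_exp_neg_mul_le hl _) (abs_nonneg _) zero_le_one
    rw [NNReal.coe_natCast] at h
    rw [← h]
    simp only [hFdef, mul_sub] at hi hFX hF0 ⊢
    rw [integral_sub hi (hFX.mul_const L), integral_mul_const, hF0, zero_mul, sub_zero]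
  change Tendsto (fun n : ℕ => ∫ ω, F (X 0 ω) * F (X n ω) ∂P) atTop (𝓝 0)
  simp_rw [he]
  -- The conditional transform given `X 0` tends to the constant `L`, and `F (X 0)` is centred.
  -- Domination needs only an eventual lower bound for the immigration exponent.
  have hlim : Tendsto (fun n : ℕ => ∫ ω, F (X 0 ω) *
      Real.exp (-(X 0 ω : ℝ) * v b c n l - immigration β b c k l n) ∂P) atTop
      (𝓝 (∫ ω, F (X 0 ω) * L ∂P)) := by
    have hI := (tendsto_immigration hb hc hX hS hl).comp tendsto_natCast_atTop_atTop
    have hv := (tendsto_v_atTop hb hc hl).comp tendsto_natCast_atTop_atTop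
    have hIb : ∀ᶠ n : ℕ in atTop, -Real.log L - 1 < immigration β b c k l n :=
      hI.eventually (lt_mem_nhds (sub_one_lt _))
    refine tendsto_integral_filter_of_dominated_convergence
      (fun _ => Real.exp (Real.log L + 1)) (Eventually.of_forall fun n => ?_)
      (hIb.mono fun n hn => ae_of_all _ fun ω => ?_)
      (integrable_const _) (ae_of_all _ fun ω => ?_)
    · have := (hX.1 0)
      exact (by fun_prop : Measurable _).aestronglyMeasurable
    · rw [norm_mul, Real.norm_eq_abs, Real.norm_eq_abs, Real.abs_exp]
      have h1 := mul_nonneg (X 0 ω).2 (v_nonneg hb hc n.cast_nonneg hl)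
      refine (mul_le_mul (hFb _) (Real.exp_le_exp.2 ?_) (Real.exp_pos _).le zero_le_one).trans
        (one_mul _).le
      have h2 : (X 0 ω).1 = (X 0 ω : ℝ) := rfl
      rw [h2] at h1
      linarith
    · refine Tendsto.const_mul _ ?_
      have h1 := ((hv.const_mul (-(X 0 ω : ℝ))).sub hI).rexp
      rwa [mul_zero, zero_sub, neg_neg, Real.exp_log hL0] at h1
  rwa [integral_mul_const, hF0, zero_mul] at hlim

/-- The strong law of large numbers for the empirical Laplace transform. -/
theorem ae_tendsto_empirical_laplace (hb : 0 < b) (hc : 0 ≤ c) (hX : IsCBIProcess P β b c k X)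
    (hS : IsStationaryProcess P X) {l : ℝ} (hl : 0 ≤ l) :
    ∀ᵐ ω ∂P, Tendsto (fun n : ℕ => 1 / (n : ℝ) *
      ∑ j ∈ Finset.Icc 1 n, Real.exp (-l * (X (j : ℝ≥0) ω : ℝ))) atTop
      (𝓝 (laplace P (X 0) l)) := by
  set L := laplace P (X 0) l with hL
  set F : ℝ≥0 → ℝ := fun x => Real.exp (-l * (x : ℝ)) - L with hFdef
  have hFm : Measurable F := (measurable_exp_neg_mul l).sub_const L
  -- The offset 1 makes the Birkhoff sum over `0, …, n - 1` the sample sum over `1, …, n`.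
  set Y : Ω → ℕ → ℝ≥0 := fun ω j => X ((j : ℝ≥0) + 1) ω with hY
  have hYm : Measurable Y := measurable_pi_lambda _ fun j => hX.1 _
  set shift : (ℕ → ℝ≥0) → ℕ → ℝ≥0 := fun y j => y (j + 1) with hshift
  have hsm : Measurable shift := measurable_pi_lambda _ fun j => measurable_pi_apply _
  have hprob : IsProbabilityMeasure (P.map Y) :=
    Measure.isProbabilityMeasure_map hYm.aemeasurable
  have hpres : MeasurePreserving shift (P.map Y) (P.map Y) := by
    refine ⟨hsm, ?_⟩
    rw [Measure.map_map hsm hYm]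
    have h := ((hS 1).comp (u := fun (x : ℝ≥0 → ℝ≥0) (j : ℕ) => x ((j : ℝ≥0) + 1))
      (measurable_pi_lambda _ fun j => measurable_pi_apply _)).map_eq
    have he : shift ∘ Y = fun ω (j : ℕ) => X ((j : ℝ≥0) + 1 + 1) ω := by
      ext ω j
      simp [hY, hshift]
    rw [he]
    exact h
  have hit (n j : ℕ) (y : ℕ → ℝ≥0) : shift^[n] y j = y (j + n) := by
    induction n generalizing y with
    | zero => rfl
    | succ n ih => rw [Function.iterate_succ_apply, ih]; simp [hshift, add_assoc]
  set f : (ℕ → ℝ≥0) → ℝ := fun y => F (y 0) with hf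
  have hfm : Measurable f := hFm.comp (measurable_pi_apply 0)
  have hfb (y : ℕ → ℝ≥0) : |f y| ≤ 1 + |L| :=
    (abs_sub _ _).trans (add_le_add (abs_exp_neg_mul_le hl _) le_rfl)
  have hr : Tendsto (fun n => ∫ y, f y * f (shift^[n] y) ∂(P.map Y)) atTop (𝓝 0) := by
    refine (tendsto_autocovariance hb hc hX hS hl).congr fun n => ?_
    rw [integral_map (f := fun y => f y * f (shift^[n] y)) hYm.aemeasurable
      (hfm.mul (hfm.comp (hsm.iterate n))).aestronglyMeasurable]
    have h := hS.integral_comp (F := fun y => F (y 0) * F (y (n : ℝ≥0)))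
      ((hFm.comp (measurable_pi_apply 0)).mul (hFm.comp (measurable_pi_apply _))) 1
    refine h.symm.trans ?_
    simp [hf, hit, hY]
  have hmain := ae_of_ae_map hYm.aemeasurable (ae_tendsto_birkhoffAverage_zero hpres hfm hfb hr)
  filter_upwards [hmain] with ω hω
  have h := hω.add_const L
  rw [zero_add] at h
  refine h.congr' ((eventually_ge_atTop 1).mono fun n hn => ?_)
  have hn : (n : ℝ) ≠ 0 := by positivity
  have hsum : ∑ j ∈ Finset.Icc 1 n, Real.exp (-l * (X (j : ℝ≥0) ω : ℝ))
      = birkhoffSum shift f n (Y ω) + n * L := by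
    clear * - hit hf hFdef hY
    induction n with
    | zero => simp
    | succ n ih =>
      rw [Finset.sum_Icc_succ_top (by lia), ih, birkhoffSum_succ]
      simp only [hf, hFdef, hit, hY]
      push_cast
      rw [zero_add]
      ring
  simp only
  rw [hsum, birkhoffAverage, smul_eq_mul]
  field_simp

end StationaryCBI

/-! ### The space `L²(w)`. -/

section Weight

variable {w : ℝ → ℝ}

theorem sqDistW_eq (hw : Measurable w) (f g : ℝ → ℝ) :
    sqDistW w f g = ∫⁻ l, ENNReal.ofReal (|f l - g l| ^ 2) ∂weightMeasure w := by
  rw [weightMeasure, lintegral_withDensity_eq_lintegral_mul_non_measurable _ hw.ennreal_ofReal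
    (ae_of_all _ fun _ => ENNReal.ofReal_lt_top), sqDistW]
  refine lintegral_congr fun l => ?_
  rw [Pi.mul_apply, ENNReal.ofReal_mul (pow_nonneg (abs_nonneg _) 2), mul_comm]

theorem weightMeasure_absolutelyContinuous (w : ℝ → ℝ) :
    weightMeasure w ≪ volume.restrict (Ioi 0) := withDensity_absolutelyContinuous _ _

theorem ae_weightMeasure_pos (w : ℝ → ℝ) : ∀ᵐ l ∂weightMeasure w, 0 < l :=
  (weightMeasure_absolutelyContinuous w).ae_le (ae_restrict_mem measurableSet_Ioi)

theorem IsWeight.exists_ae_le (hw : IsWeight w) : ∃ Λ, 0 < Λ ∧ ∀ᵐ l ∂weightMeasure w, l ≤ Λ := by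
  obtain ⟨M, hM⟩ := hw.compact_support.bddAbove
  refine ⟨max M 1, lt_max_of_lt_right one_pos, ?_⟩
  filter_upwards [Measure.support_mem_ae (μ := weightMeasure w)] with l hl
  exact (hM hl).trans (le_max_left _ _)

theorem IsWeight.isFiniteMeasure (hw : IsWeight w) : IsFiniteMeasure (weightMeasure w) := by
  obtain ⟨Λ, -, hΛ⟩ := hw.exists_ae_le
  obtain ⟨C, hC⟩ := hw.bounded
  refine ⟨?_⟩
  rw [← measure_add_measure_compl (measurableSet_Iic (a := Λ))]
  have h1 : weightMeasure w (Iic Λ)ᶜ = 0 := hΛ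
  rw [h1, add_zero, weightMeasure, withDensity_apply _ measurableSet_Iic,
    Measure.restrict_restrict measurableSet_Iic]
  calc ∫⁻ l in Iic Λ ∩ Ioi 0, ENNReal.ofReal (w l)
      ≤ ∫⁻ _ in Iic Λ ∩ Ioi 0, ENNReal.ofReal C :=
        setLIntegral_mono measurable_const fun l hl => ENNReal.ofReal_le_ofReal (hC l hl.2)
    _ < ∞ := by
        rw [setLIntegral_const, inter_comm, Ioi_inter_Iic]
        exact ENNReal.mul_lt_top ENNReal.ofReal_lt_top measure_Ioc_lt_top

theorem sqDistW_congr_left {f f' g : ℝ → ℝ} (hw : Measurable w) (h : f =ᵐ[weightMeasure w] f') :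
    sqDistW w f g = sqDistW w f' g := by
  rw [sqDistW_eq hw, sqDistW_eq hw]
  exact lintegral_congr_ae (h.mono fun l hl => by simp only [hl])

theorem sqDistW_comm (w f g : ℝ → ℝ) : sqDistW w f g = sqDistW w g f := by
  simp only [sqDistW, abs_sub_comm]

theorem sqDistW_le_add {f g h : ℝ → ℝ} (hw : Measurable w)
    (hg : AEMeasurable g (weightMeasure w)) (hh : AEMeasurable h (weightMeasure w)) :
    sqDistW w f h ≤ 2 * sqDistW w f g + 2 * sqDistW w g h := by
  simp only [sqDistW_eq hw]
  have hm : AEMeasurable (fun l => ENNReal.ofReal (|g l - h l| ^ 2)) (weightMeasure w) := by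
    simp only [sq_abs]
    exact ((hg.sub hh).pow_const 2).ennreal_ofReal
  rw [← lintegral_const_mul' _ _ ENNReal.ofNat_ne_top,
    ← lintegral_const_mul' _ _ ENNReal.ofNat_ne_top, ← lintegral_add_right' _ (hm.const_mul 2)]
  refine lintegral_mono fun l => ?_
  have h2 : (2 : ℝ≥0∞) = ENNReal.ofReal 2 := by simp
  rw [h2, ← ENNReal.ofReal_mul zero_le_two, ← ENNReal.ofReal_mul zero_le_two,
    ← ENNReal.ofReal_add (by positivity) (by positivity)]
  refine ENNReal.ofReal_le_ofReal ?_
  rw [sq_abs, sq_abs, sq_abs]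
  nlinarith [sq_nonneg ((f l - g l) - (g l - h l))]

theorem aemeasurable_T {β b c : ℝ} {k : ℝ → ℝ} (hβ : 0 ≤ β) (hb : 0 < b) (hc : 0 ≤ c)
    (hk : IntegrableMu k) (h0 : ∀ z, 0 < z → 0 ≤ k z) (hT : TFinite b c k) :
    AEMeasurable (T β b c k) (weightMeasure w) :=
  (aemeasurable_restrict_of_antitoneOn measurableSet_Ioi
    (antitoneOn_T hβ hb hc hk h0 hT)).mono_ac (weightMeasure_absolutelyContinuous w)

end Weight

/-! ### Consistency of the log empirical Laplace transform. -/

section Consistency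

variable {Ω : Type*} [MeasurableSpace Ω] {P : Measure Ω} [IsProbabilityMeasure P]
  {β b c : ℝ} {k w : ℝ → ℝ} {X : ℝ≥0 → Ω → ℝ≥0}

/-- The empirical Laplace transform. -/
noncomputable def empiricalLaplace (X : ℝ≥0 → Ω → ℝ≥0) (n : ℕ) (ω : Ω) (l : ℝ) : ℝ :=
  1 / (n : ℝ) * ∑ j ∈ Finset.Icc 1 n, Real.exp (-l * (X (j : ℝ≥0) ω : ℝ))

theorem measurable_empiricalLaplace (hX : ∀ t, Measurable (X t)) (n : ℕ) :
    Measurable fun p : Ω × ℝ => empiricalLaplace X n p.1 p.2 := by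
  unfold empiricalLaplace
  fun_prop

omit [MeasurableSpace Ω] in
theorem antitone_empiricalLaplace (X : ℝ≥0 → Ω → ℝ≥0) (n : ℕ) (ω : Ω) :
    Antitone (empiricalLaplace X n ω) := by
  intro x y h
  refine mul_le_mul_of_nonneg_left (Finset.sum_le_sum fun j _ => Real.exp_le_exp.2 ?_)
    (by positivity)
  exact mul_le_mul_of_nonneg_right (neg_le_neg h) (X j ω).coe_nonneg

omit [MeasurableSpace Ω] in
theorem empiricalLaplace_le_one (X : ℝ≥0 → Ω → ℝ≥0) (n : ℕ) (ω : Ω) {l : ℝ} (hl : 0 ≤ l) :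
    empiricalLaplace X n ω l ≤ 1 := by
  refine (antitone_empiricalLaplace X n ω hl).trans ?_
  rcases Nat.eq_zero_or_pos n with rfl | hn
  · simp [empiricalLaplace]
  · have : (n : ℝ) ≠ 0 := by positivity
    simp [empiricalLaplace, this]

theorem antitoneOn_laplace {Y : Ω → ℝ≥0} (hY : Measurable Y) :
    AntitoneOn (laplace P Y) (Ici 0) := fun _ hx _ hy h =>
  integral_mono (integrable_exp_neg_mul hY hy) (integrable_exp_neg_mul hY hx) fun ω =>
    Real.exp_le_exp.2 (mul_le_mul_of_nonneg_right (neg_le_neg h) (Y ω).coe_nonneg)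

theorem measurable_laplace {Y : Ω → ℝ≥0} (hY : Measurable Y) : Measurable (laplace P Y) := by
  have : StronglyMeasurable fun p : ℝ × Ω => Real.exp (-p.1 * (Y p.2 : ℝ)) :=
    (by fun_prop : Measurable _).stronglyMeasurable
  exact this.integral_prod_right.measurable

/-- The exceptional event in the law of large numbers depends on `l`; Fubini trades it for one event
outside which almost every `l` is good. -/
theorem ae_ae_tendsto_empiricalLaplace (hb : 0 < b) (hc : 0 ≤ c) (hX : IsCBIProcess P β b c k X)
    (hS : IsStationaryProcess P X) (hw : IsWeight w) :
    ∀ᵐ ω ∂P, ∀ᵐ l ∂weightMeasure w,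
      Tendsto (fun n => empiricalLaplace X n ω l) atTop (𝓝 (laplace P (X 0) l)) := by
  have := hw.isFiniteMeasure
  rw [Measure.ae_ae_comm]
  · filter_upwards [ae_weightMeasure_pos w] with l hl
    exact ae_tendsto_empirical_laplace hb hc hX hS hl.le
  · exact measurableSet_tendsto_fun (fun n => measurable_empiricalLaplace hX.1 n)
      ((measurable_laplace (hX.1 0)).comp measurable_snd)

/-- The logarithm of the empirical Laplace transform is a consistent estimator in `L²(w)`. -/
theorem ae_tendsto_sqDistW_logEmpiricalLaplace (hβ : 0 ≤ β) (hb : 0 < b) (hc : 0 ≤ c)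
    (hk : IntegrableMu k) (h0 : ∀ z, 0 < z → 0 ≤ k z) (hX : IsCBIProcess P β b c k X)
    (hS : IsStationaryProcess P X) (hw : IsWeight w) :
    ∀ᵐ ω ∂P, Tendsto (fun n => sqDistW w (logEmpiricalLaplace X n ω) (T β b c k)) atTop (𝓝 0) := by
  have := hw.isFiniteMeasure
  obtain ⟨Λ, hΛ0, hΛ⟩ := hw.exists_ae_le
  -- Both transforms decrease in `l`, so convergence at the right end `Λ` of the support alone gives
  -- the eventual lower bound `δ` on all of it, and hence a constant dominating the logarithms.
  set δ := laplace P (X 0) Λ / 2 with hδ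
  have hLΛ := laplace_pos (P := P) (hX.1 0) hΛ0.le
  have hδ0 : 0 < δ := half_pos hLΛ
  filter_upwards [ae_ae_tendsto_empiricalLaplace hb hc hX hS hw,
    ae_tendsto_empirical_laplace hb hc hX hS hΛ0.le] with ω hω hωΛ
  have hev : ∀ᶠ n in atTop, δ < empiricalLaplace X n ω Λ :=
    hωΛ.eventually (lt_mem_nhds (half_lt_self hLΛ))
  simp only [sqDistW_eq hw.measurable]
  have hm (n : ℕ) : Measurable (logEmpiricalLaplace X n ω) :=
    ((measurable_empiricalLaplace hX.1 n).comp measurable_prodMk_left).log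
  have hTl : ∀ᵐ l ∂weightMeasure w, T β b c k l = Real.log (laplace P (X 0) l) :=
    (ae_weightMeasure_pos w).mono fun l hl => T_eq_log_laplace hβ hb hc hk h0 hX hS hl
  have hTm := aemeasurable_T (w := w) hβ hb hc hk h0 (tFinite_of_stationary hβ hb hc hk h0 hX hS)
  have key : Tendsto (fun n => ∫⁻ l, ENNReal.ofReal
      (|logEmpiricalLaplace X n ω l - T β b c k l| ^ 2) ∂weightMeasure w) atTop
      (𝓝 (∫⁻ _, 0 ∂weightMeasure w)) := by
    refine tendsto_lintegral_filter_of_dominated_convergence'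
      (fun _ => ENNReal.ofReal (Real.log δ ^ 2)) (Eventually.of_forall fun n => ?_)
      (hev.mono fun n hn => ?_) (by simp [ENNReal.mul_eq_top]) ?_
    · simp only [sq_abs]
      exact (((hm n).aemeasurable.sub hTm).pow_const 2).ennreal_ofReal
    · filter_upwards [hΛ, ae_weightMeasure_pos w, hTl] with l hl hl0 hT
      have h1 : Real.log δ ≤ logEmpiricalLaplace X n ω l :=
        Real.log_le_log hδ0 (hn.le.trans (antitone_empiricalLaplace X n ω hl))
      have h2 : logEmpiricalLaplace X n ω l ≤ 0 :=
        Real.log_nonpos ((hδ0.le.trans hn.le).trans (antitone_empiricalLaplace X n ω hl))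
          (empiricalLaplace_le_one X n ω hl0.le)
      have h3 : Real.log δ ≤ T β b c k l := by
        rw [hT]
        refine Real.log_le_log hδ0 ((half_le_self hLΛ.le).trans ?_)
        exact antitoneOn_laplace (hX.1 0) hl0.le hΛ0.le hl
      have h4 : T β b c k l ≤ 0 := by
        rw [hT]
        exact Real.log_nonpos (laplace_pos (hX.1 0) hl0.le).le (laplace_le_one (hX.1 0) hl0.le)
      refine ENNReal.ofReal_le_ofReal ?_
      rw [← sq_abs (Real.log δ)]
      refine pow_le_pow_left₀ (abs_nonneg _) ?_ 2
      rw [abs_of_nonpos (h1.trans h2), abs_le]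
      constructor <;> linarith
    · filter_upwards [hω, ae_weightMeasure_pos w, hTl] with l hl hl0 hT
      have h1 : Tendsto (fun n => logEmpiricalLaplace X n ω l) atTop (𝓝 (T β b c k l)) := by
        rw [hT]
        exact hl.log (laplace_pos (hX.1 0) hl0.le).ne'
      have h2 := ENNReal.tendsto_ofReal (((h1.sub_const (T β b c k l)).abs).pow 2)
      simpa using h2
  simpa using key

end Consistency

end CBI

/-! ### Helly selection and compactness of the class. -/

section Helly

/-- Helly's selection theorem for monotone functions. -/
theorem exists_subseq_tendsto_of_monotone {α : Type*} [CompleteLinearOrder α] [TopologicalSpace α]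
    [OrderTopology α] [SecondCountableTopology α] {f : ℕ → ℝ → α} (hf : ∀ n, Monotone (f n)) :
    ∃ φ : ℕ → ℕ, StrictMono φ ∧ ∃ F : ℝ → α,
      ∀ᵐ x, Tendsto (fun n => f (φ n) x) atTop (𝓝 (F x)) := by
  -- Compactness of the product over the rationals replaces the diagonal argument. At a continuity
  -- point of the monotone upper limit, a rational just to the left forces the lower limit to agree.
  obtain ⟨g, φ, hφ, hg⟩ := CompactSpace.tendsto_subseq fun n (q : ℚ) => f n q
  rw [tendsto_pi_nhds] at hg
  refine ⟨φ, hφ, fun x => limsup (fun n => f (φ n) x) atTop, ?_⟩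
  have hmono : Monotone fun x => limsup (fun n => f (φ n) x) atTop := fun x y h =>
    limsup_le_limsup (Eventually.of_forall fun n => hf _ h)
  filter_upwards [hmono.countable_not_continuousAt.ae_notMem volume] with x hx
  have hc : ContinuousAt (fun x => limsup (fun n => f (φ n) x) atTop) x := by
    simpa using hx
  refine tendsto_of_le_liminf_of_limsup_le ?_ le_rfl
  refine le_of_tendsto (hc.tendsto.mono_left (nhdsWithin_le_nhds (s := Iio x))) ?_
  filter_upwards [self_mem_nhdsWithin] with y hy
  obtain ⟨q, hyq, hqx⟩ := exists_rat_btwn (show y < x from hy)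
  calc limsup (fun n => f (φ n) y) atTop ≤ limsup (fun n => f (φ n) q) atTop := hmono hyq.le
    _ = liminf (fun n => f (φ n) q) atTop := (hg q).limsup_eq.trans (hg q).liminf_eq.symm
    _ ≤ _ := liminf_le_liminf (Eventually.of_forall fun n => hf _ hqx.le)

/-- Extending by `⊥` to the left of 0 keeps monotonicity in `EReal`; the bound `B` keeps the limits
finite. -/
theorem exists_subseq_tendsto_of_monotoneOn {f : ℕ → ℝ → ℝ} (hf : ∀ n, MonotoneOn (f n) (Ioi 0))
    {B : ℝ → ℝ} (hB : ∀ x, 0 < x → ∀ n, |f n x| ≤ B x) :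
    ∃ φ : ℕ → ℕ, StrictMono φ ∧ ∃ F : ℝ → ℝ,
      ∀ᵐ x ∂volume.restrict (Ioi 0), Tendsto (fun n => f (φ n) x) atTop (𝓝 (F x)) := by
  classical
  obtain ⟨φ, hφ, F, hF⟩ := exists_subseq_tendsto_of_monotone
    (f := fun n x => if 0 < x then (f n x : EReal) else ⊥) fun n x y h => by
      by_cases hx : 0 < x
      · simpa [hx, hx.trans_le h] using hf n hx (hx.trans_le h) h
      · simp [hx]
  refine ⟨φ, hφ, fun x => (F x).toReal, ?_⟩
  rw [ae_restrict_iff' measurableSet_Ioi]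
  filter_upwards [hF] with x hx hx0
  have hx0 : 0 < x := hx0
  simp only [hx0, if_true] at hx
  have h1 : F x ≤ (B x : EReal) := le_of_tendsto' hx fun n =>
    EReal.coe_le_coe_iff.2 (abs_le.1 (hB x hx0 _)).2
  have h2 : ((-B x : ℝ) : EReal) ≤ F x := ge_of_tendsto' hx fun n =>
    EReal.coe_le_coe_iff.2 (abs_le.1 (hB x hx0 _)).1
  exact (EReal.tendsto_toReal (h1.trans_lt (EReal.coe_lt_top _)).ne
    ((EReal.bot_lt_coe _).trans_le h2).ne').comp hx

end Helly

namespace CBI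

variable {R : ℝ} {kt k : ℝ → ℝ}

theorem eVariationOn_dyadic_le
    (h : ∀ i : ℤ, eVariationOn k (Icc ((2 : ℝ) ^ i) ((2 : ℝ) ^ (i + 1))) ≤ ENNReal.ofReal R)
    (i : ℤ) (N : ℕ) :
    eVariationOn k (Icc ((2 : ℝ) ^ i) ((2 : ℝ) ^ (i + N))) ≤ N * ENNReal.ofReal R := by
  induction N with
  | zero => simp
  | succ N ih =>
    have h1 : (2 : ℝ) ^ i ≤ 2 ^ (i + N) := zpow_le_zpow_right₀ one_le_two (by lia)
    have h2 : (2 : ℝ) ^ (i + N) ≤ 2 ^ (i + N + 1) := zpow_le_zpow_right₀ one_le_two (by lia)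
    have h3 := eVariationOn.Icc_add_Icc k (s := univ) h1 h2 (mem_univ _)
    simp only [univ_inter] at h3
    rw [Nat.cast_succ, ← add_assoc, ← h3, Nat.cast_succ, add_mul, one_mul]
    exact add_le_add ih (h _)

theorem IsInKR.abs_variationOnFromTo_le (hk : IsInKR R kt k) {N : ℕ} {x : ℝ}
    (h1 : (2 : ℝ) ^ (-(N : ℤ)) ≤ x) (h2 : x ≤ (2 : ℝ) ^ (N : ℤ)) :
    |variationOnFromTo k (Ioi 0) 1 x| ≤ (((2 * N : ℕ) : ℝ≥0∞) * ENNReal.ofReal R).toReal := by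
  have hv := eVariationOn_dyadic_le hk.variation_le (-(N : ℤ)) (2 * N)
  have he : -(N : ℤ) + (2 * N : ℕ) = N := by push_cast; ring
  rw [he] at hv
  have htop : ((2 * N : ℕ) : ℝ≥0∞) * ENNReal.ofReal R ≠ ∞ :=
    ENNReal.mul_ne_top (ENNReal.natCast_ne_top _) ENNReal.ofReal_ne_top
  have h3 : (2 : ℝ) ^ (-(N : ℤ)) ≤ 1 := zpow_le_one_of_nonpos₀ one_le_two (by lia)
  have h4 : (1 : ℝ) ≤ (2 : ℝ) ^ (N : ℤ) := one_le_zpow₀ one_le_two (by lia)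
  rcases le_total 1 x with h | h
  · rw [variationOnFromTo.eq_of_le _ _ h, ENNReal.abs_toReal]
    refine ENNReal.toReal_mono htop ((eVariationOn.mono _ ?_).trans hv)
    exact inter_subset_right.trans (Icc_subset_Icc h3 h2)
  · rw [variationOnFromTo.eq_of_ge _ _ h, abs_neg, ENNReal.abs_toReal]
    refine ENNReal.toReal_mono htop ((eVariationOn.mono _ ?_).trans hv)
    exact inter_subset_right.trans (Icc_subset_Icc h1 h4)

theorem exists_dyadic_bounds {x : ℝ} (hx : 0 < x) :
    ∃ N : ℕ, (2 : ℝ) ^ (-(N : ℤ)) ≤ x ∧ x ≤ (2 : ℝ) ^ (N : ℤ) := by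
  obtain ⟨n, hn⟩ := pow_unbounded_of_one_lt x one_lt_two
  obtain ⟨m, hm⟩ := exists_pow_lt_of_lt_one hx (show (2 : ℝ)⁻¹ < 1 by norm_num)
  refine ⟨max n m, ?_, ?_⟩
  · rw [zpow_neg, zpow_natCast, ← inv_pow]
    exact (pow_le_pow_of_le_one (by norm_num) (by norm_num) (le_max_right _ _)).trans hm.le
  · rw [zpow_natCast]
    exact hn.le.trans (pow_le_pow_right₀ one_le_two (le_max_left _ _))

/-- Sequential compactness of `K̃_R` for almost everywhere convergence. -/
theorem exists_subseq_tendsto_of_isInKR {kn : ℕ → ℝ → ℝ} (hk : ∀ n, IsInKR R kt (kn n)) :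
    ∃ φ : ℕ → ℕ, StrictMono φ ∧ ∃ κ : ℝ → ℝ,
      ∀ᵐ x ∂volume.restrict (Ioi 0), Tendsto (fun n => kn (φ n) x) atTop (𝓝 (κ x)) := by
  choose! N hN1 hN2 using fun x : ℝ => exists_dyadic_bounds (x := x)
  have hb (n : ℕ) (x : ℝ) (hx : 0 < x) := (hk n).abs_variationOnFromTo_le (hN1 x hx) (hN2 x hx)
  have h1 : (1 : ℝ) ∈ Ioi 0 := mem_Ioi.2 one_pos
  -- Jordan decomposition based at 1: Helly is applied to the variation function and again to its
  -- difference with the density. The bounds are uniform in `n` thanks to the dyadic variation bound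
  -- and the envelope.
  obtain ⟨φ, hφ, p, hp⟩ := exists_subseq_tendsto_of_monotoneOn
    (fun n => variationOnFromTo.monotoneOn (hk n).inK.locallyBV h1) fun x hx n => hb n x hx
  obtain ⟨ψ, hψ, q, hq⟩ := exists_subseq_tendsto_of_monotoneOn
    (fun n => variationOnFromTo.sub_self_monotoneOn (hk (φ n)).inK.locallyBV h1)
    (B := fun x => (((2 * N x : ℕ) : ℝ≥0∞) * ENNReal.ofReal R).toReal + kt x)
    fun x hx n => (abs_sub _ _).trans (add_le_add (hb _ x hx) (by
      rw [abs_of_nonneg ((hk (φ n)).inK.nonneg x hx)]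
      exact (hk (φ n)).le_envelope x hx))
  refine ⟨φ ∘ ψ, hφ.comp hψ, fun x => p x - q x, ?_⟩
  filter_upwards [hp, hq] with x hpx hqx
  refine ((hpx.comp hψ.tendsto_atTop).sub hqx).congr fun n => ?_
  simp

end CBI

/-! ### Uniqueness of Laplace transforms on an interval. -/

section LaplaceUniqueness

variable {μ ν : Measure ℝ} [IsFiniteMeasure μ] [IsFiniteMeasure ν]

theorem Iio_subset_interior_integrableExpSet (hμ : ∀ᵐ x ∂μ, 0 ≤ x) :
    Iio 0 ⊆ interior (integrableExpSet id μ) := by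
  refine interior_maximal (fun t ht => ?_) isOpen_Iio
  refine Integrable.of_bound (C := 1) (by fun_prop : Measurable _).aestronglyMeasurable
    (hμ.mono fun x hx => ?_)
  rw [Real.norm_eq_abs, Real.abs_exp, Real.exp_le_one_iff]
  exact mul_nonpos_of_nonpos_of_nonneg (le_of_lt ht) hx

theorem re_neg_one_div_add_mul_I (n : ℕ) (t : ℝ) :
    (-(1 / ((n : ℂ) + 1)) + t * Complex.I).re = -(1 / ((n : ℝ) + 1)) := by
  have h : (1 / ((n : ℂ) + 1)) = ((1 / ((n : ℝ) + 1) : ℝ) : ℂ) := by push_cast; rfl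
  rw [h, Complex.add_re, Complex.neg_re, Complex.ofReal_re, Complex.re_ofReal_mul, Complex.I_re,
    mul_zero, add_zero]

/-- The imaginary axis may lie on the boundary of the domain of analyticity, so the characteristic
function is reached as a limit from the left half-plane. -/
theorem tendsto_complexMGF_charFun (hμ : ∀ᵐ x ∂μ, 0 ≤ x) (t : ℝ) :
    Tendsto (fun n : ℕ => complexMGF id μ (-(1 / ((n : ℂ) + 1)) + t * Complex.I)) atTop
      (𝓝 (charFun μ t)) := by
  rw [← complexMGF_id_mul_I]
  unfold complexMGF
  refine tendsto_integral_of_dominated_convergence (fun _ => 1)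
    (fun n => Continuous.aestronglyMeasurable (by fun_prop)) (integrable_const _)
    (fun n => hμ.mono fun x hx => ?_) (ae_of_all _ fun x => ?_)
  · rw [Complex.norm_exp, Real.exp_le_one_iff, Complex.re_mul_ofReal, re_neg_one_div_add_mul_I, id]
    have : 0 ≤ 1 / ((n : ℝ) + 1) := by positivity
    nlinarith
  · have h1 : Tendsto (fun n : ℕ => -(1 / ((n : ℂ) + 1)) + t * Complex.I) atTop
        (𝓝 (-0 + t * Complex.I)) :=
      (tendsto_one_div_add_atTop_nhds_zero_nat (𝕜 := ℂ)).neg.add_const _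
    rw [neg_zero, zero_add] at h1
    exact (Complex.continuous_exp.tendsto _).comp (h1.mul_const _)

/-- A finite measure on `[0, ∞)` is determined by its Laplace transform on any interval `(0, a)`. -/
theorem MeasureTheory.Measure.ext_of_laplace_eqOn (hμ : ∀ᵐ x ∂μ, 0 ≤ x) (hν : ∀ᵐ x ∂ν, 0 ≤ x)
    {a : ℝ} (ha : 0 < a)
    (h : ∀ t ∈ Ioo 0 a, ∫ x, Real.exp (-t * x) ∂μ = ∫ x, Real.exp (-t * x) ∂ν) : μ = ν := by
  have hsub {ρ : Measure ℝ} [IsFiniteMeasure ρ] (hρ : ∀ᵐ x ∂ρ, 0 ≤ x) :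
      AnalyticOnNhd ℂ (complexMGF id ρ) {z | z.re < 0} :=
    analyticOnNhd_complexMGF.mono fun z hz => Iio_subset_interior_integrableExpSet hρ hz
  -- Identity theorem: agreement on a real segment, which accumulates at `-a / 2`, spreads over the
  -- half-plane.
  have heq : EqOn (complexMGF id μ) (complexMGF id ν) {z | z.re < 0} := by
    refine AnalyticOnNhd.eqOn_of_preconnected_of_frequently_eq (hsub hμ) (hsub hν)
      (convex_halfSpace_re_lt 0).isPreconnected (z₀ := ((-(a / 2) : ℝ) : ℂ))
      (by simpa using ha) ?_
    have hreal : ∃ᶠ x : ℝ in 𝓝[≠] (-(a / 2)), complexMGF id μ x = complexMGF id ν x := by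
      have hmem : Ioo (-a) 0 ∈ 𝓝[≠] (-(a / 2)) :=
        nhdsWithin_le_nhds (Ioo_mem_nhds (by linarith) (by linarith))
      refine Eventually.frequently ?_
      filter_upwards [hmem] with y hy
      have := h (-y) ⟨by linarith [hy.2], by linarith [hy.1]⟩
      rw [complexMGF_ofReal, complexMGF_ofReal]
      simpa [mgf] using this
    rw [frequently_iff_seq_forall] at hreal ⊢
    obtain ⟨xs, hxs, hx⟩ := hreal
    refine ⟨fun n => xs n, ?_, fun n => hx n⟩
    rw [tendsto_nhdsWithin_iff] at hxs ⊢
    refine ⟨?_, hxs.2.mono fun n hn h' => hn (Complex.ofReal_injective h')⟩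
    exact (Complex.continuous_ofReal.tendsto _).comp hxs.1
  refine Measure.ext_of_charFun (funext fun t => ?_)
  refine tendsto_nhds_unique (tendsto_complexMGF_charFun hμ t)
    ((tendsto_complexMGF_charFun hν t).congr fun n => (heq ?_).symm)
  rw [mem_ofPred_eq, re_neg_one_div_add_mul_I, neg_lt_zero]
  positivity

end LaplaceUniqueness

namespace CBI

/-! ### The Lévy density is determined by `psi` near zero. -/

section Injectivity

variable {β b c : ℝ} {k k₁ k₂ kt : ℝ → ℝ}

/-- The density `k` may have infinite mass near 0; increments of `psi` give Laplace transforms of a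
tilted density of finite mass. -/
theorem psi_add_sub_psi (hk : IntegrableMu k) {t h : ℝ} (ht : 0 ≤ t) (hh : 0 ≤ h) :
    ∫ u in Ioi (0 : ℝ), (1 - Real.exp (-h * u)) * k u * Real.exp (-t * u)
      = psi β k (t + h) - psi β k t - β * h := by
  have h1 := integral_sub (integrableOn_one_sub_exp_mul hk (add_nonneg ht hh))
    (integrableOn_one_sub_exp_mul hk ht)
  have h2 (u : ℝ) : (1 - Real.exp (-h * u)) * k u * Real.exp (-t * u)
      = (1 - Real.exp (-(t + h) * u)) * k u - (1 - Real.exp (-t * u)) * k u := by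
    rw [show -(t + h) * u = -t * u + -h * u by ring, Real.exp_add]
    ring
  simp_rw [h2]
  rw [h1, psi, psi]
  ring

/-- The Lévy density is determined by the immigration mechanism on any interval `(0, a)`. -/
theorem ae_eq_of_psi_eqOn (h₁ : IntegrableMu k₁) (h₂ : IntegrableMu k₂)
    (p₁ : ∀ᵐ u ∂volume.restrict (Ioi 0), 0 ≤ k₁ u) (p₂ : ∀ᵐ u ∂volume.restrict (Ioi 0), 0 ≤ k₂ u)
    {a : ℝ} (ha : 0 < a) (h : EqOn (psi β k₁) (psi β k₂) (Ioo 0 a)) :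
    k₁ =ᵐ[volume.restrict (Ioi 0)] k₂ := by
  have hpos : ∀ᵐ u ∂volume.restrict (Ioi (0 : ℝ)), 0 < u := ae_restrict_mem measurableSet_Ioi
  -- With increment `a / 2`, both `t` and `t + a / 2` stay in `(0, a)` for `t` in `(0, a / 2)`.
  set d : (ℝ → ℝ) → ℝ → ℝ := fun k u => (1 - Real.exp (-(a / 2) * u)) * k u with hd
  have hfac {u : ℝ} (hu : 0 < u) : 0 < 1 - Real.exp (-(a / 2) * u) :=
    sub_pos.2 (Real.exp_lt_one_iff.2 (by nlinarith))
  have hint {k : ℝ → ℝ} (hk : IntegrableMu k) : IntegrableOn (d k) (Ioi 0) :=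
    integrableOn_one_sub_exp_mul hk (half_pos ha).le
  have hnn {k : ℝ → ℝ} (hp : ∀ᵐ u ∂volume.restrict (Ioi 0), 0 ≤ k u) :
      ∀ᵐ u ∂volume.restrict (Ioi 0), 0 ≤ d k u := by
    filter_upwards [hp, hpos] with u hu hu0
    exact mul_nonneg (hfac hu0).le hu
  have hfin {k : ℝ → ℝ} (hk : IntegrableMu k) : IsFiniteMeasure
      ((volume.restrict (Ioi 0)).withDensity fun u => ENNReal.ofReal (d k u)) :=
    isFiniteMeasure_withDensity_ofReal (hint hk).2
  have hae (k : ℝ → ℝ) : ∀ᵐ u ∂(volume.restrict (Ioi 0)).withDensity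
      fun u => ENNReal.ofReal (d k u), 0 ≤ u :=
    (withDensity_absolutelyContinuous _ _).ae_le (hpos.mono fun u hu => hu.le)
  have hlap {k : ℝ → ℝ} (hk : IntegrableMu k) (hp : ∀ᵐ u ∂volume.restrict (Ioi 0), 0 ≤ k u)
      (t : ℝ) : ∫ u, Real.exp (-t * u) ∂(volume.restrict (Ioi 0)).withDensity
        (fun u => ENNReal.ofReal (d k u)) = ∫ u in Ioi (0 : ℝ), d k u * Real.exp (-t * u) := by
    rw [integral_withDensity_eq_integral_toReal_smul₀ (hint hk).1.aemeasurable.ennreal_ofReal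
      (ae_of_all _ fun _ => ENNReal.ofReal_lt_top)]
    refine integral_congr_ae ((hnn hp).mono fun u hu => ?_)
    simp only [smul_eq_mul, ENNReal.toReal_ofReal hu]
  have := hfin h₁
  have := hfin h₂
  have hmeas := Measure.ext_of_laplace_eqOn (hae k₁) (hae k₂) (half_pos ha) fun t ht => by
    rw [hlap h₁ p₁, hlap h₂ p₂, psi_add_sub_psi (β := β) h₁ ht.1.le (half_pos ha).le,
      psi_add_sub_psi (β := β) h₂ ht.1.le (half_pos ha).le,
      h ⟨ht.1, by linarith [ht.2]⟩, h ⟨by linarith [ht.1], by linarith [ht.2]⟩]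
  have hde := (withDensity_eq_iff (hint h₁).1.aemeasurable.ennreal_ofReal
    (hint h₂).1.aemeasurable.ennreal_ofReal
    ((hasFiniteIntegral_iff_ofReal (hnn p₁)).1 (hint h₁).2).ne).1 hmeas
  filter_upwards [hde, hnn p₁, hnn p₂, hpos] with u hu n₁ n₂ hu0
  have h3 := (ENNReal.ofReal_eq_ofReal_iff n₁ n₂).1 hu
  exact mul_left_cancel₀ (hfac hu0).ne' h3

end Injectivity

/-! ### Passage to the limit under the envelope. -/

section Convergence

variable {β b c : ℝ} {kn : ℕ → ℝ → ℝ} {k κ kt : ℝ → ℝ}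

theorem IntegrableMu.mono (hkt : IntegrableMu kt)
    (hk : AEStronglyMeasurable k (volume.restrict (Ioi 0)))
    (h : ∀ᵐ u ∂volume.restrict (Ioi 0), |k u| ≤ kt u) : IntegrableMu k := by
  refine Integrable.mono' hkt
    (hk.mul (by fun_prop : Continuous fun u : ℝ => min u 1).aestronglyMeasurable) ?_
  filter_upwards [h, ae_restrict_mem measurableSet_Ioi] with u hu hu0
  have hm : 0 ≤ min u 1 := le_min (le_of_lt hu0) zero_le_one
  rw [norm_mul, Real.norm_of_nonneg hm]
  exact mul_le_mul_of_nonneg_right hu hm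

theorem abs_psi_le (hβ : 0 ≤ β) (hkt : IntegrableMu kt)
    (h : ∀ u, 0 < u → |k u| ≤ kt u) {z : ℝ} (hz : 0 ≤ z) : |psi β k z| ≤ psi β kt z := by
  unfold psi
  refine (abs_add_le _ _).trans (add_le_add (abs_of_nonneg (mul_nonneg hβ hz)).le ?_)
  rw [← Real.norm_eq_abs]
  refine norm_integral_le_of_norm_le (integrableOn_one_sub_exp_mul hkt hz)
    ((ae_restrict_mem measurableSet_Ioi).mono fun u hu => ?_)
  have h1 := one_sub_exp_neg_mul_nonneg hz (le_of_lt hu)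
  rw [norm_mul, Real.norm_of_nonneg h1]
  exact mul_le_mul_of_nonneg_left (h u hu) h1

theorem tendsto_psi (hkn : ∀ n, IntegrableMu (kn n)) (hkt : IntegrableMu kt)
    (h : ∀ n u, 0 < u → |kn n u| ≤ kt u)
    (hlim : ∀ᵐ u ∂volume.restrict (Ioi 0), Tendsto (fun n => kn n u) atTop (𝓝 (κ u)))
    (β : ℝ) {z : ℝ} (hz : 0 ≤ z) :
    Tendsto (fun n => psi β (kn n) z) atTop (𝓝 (psi β κ z)) := by
  refine Tendsto.const_add _ (tendsto_integral_of_dominated_convergence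
    (fun u => (1 - Real.exp (-z * u)) * kt u)
    (fun n => aestronglyMeasurable_one_sub_exp_mul (hkn n) z)
    (integrableOn_one_sub_exp_mul hkt hz)
    (fun n => (ae_restrict_mem measurableSet_Ioi).mono fun u hu => ?_)
    (hlim.mono fun u hu => hu.const_mul _))
  have h1 := one_sub_exp_neg_mul_nonneg hz (le_of_lt hu)
  rw [norm_mul, Real.norm_of_nonneg h1]
  exact mul_le_mul_of_nonneg_left (h n u hu) h1

theorem tendsto_immigration_of_tendsto (hβ : 0 ≤ β) (hb : 0 < b) (hc : 0 ≤ c)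
    (hkn : ∀ n, IntegrableMu (kn n)) (hkt : IntegrableMu kt)
    (h : ∀ n u, 0 < u → |kn n u| ≤ kt u)
    (hlim : ∀ᵐ u ∂volume.restrict (Ioi 0), Tendsto (fun n => kn n u) atTop (𝓝 (κ u)))
    {l t : ℝ} (hl : 0 ≤ l) (ht : 0 ≤ t) :
    Tendsto (fun n => immigration β b c (kn n) l t) atTop (𝓝 (immigration β b c κ l t)) := by
  refine intervalIntegral.tendsto_integral_filter_of_dominated_convergence
    (fun s => psi β kt (v b c s l)) (Eventually.of_forall fun n => ?_)
    (Eventually.of_forall fun n => ae_of_all _ fun s hs => ?_)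
    (intervalIntegrable_psi_v hb hc hkt β hl ht) (ae_of_all _ fun s hs => ?_)
  · rw [uIoc_of_le ht]
    exact (intervalIntegrable_psi_v hb hc (hkn n) β hl ht).1.1
  · rw [uIoc_of_le ht] at hs
    exact abs_psi_le hβ hkt (h n) (v_nonneg hb hc hs.1.le hl)
  · rw [uIoc_of_le ht] at hs
    exact tendsto_psi hkn hkt h hlim β (v_nonneg hb hc hs.1.le hl)

theorem tendsto_distMu (hkn : ∀ n, IntegrableMu (kn n)) (hkt : IntegrableMu kt)
    (h : ∀ n u, 0 < u → |kn n u| ≤ kt u) (hκ : IntegrableMu κ)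
    (hκt : ∀ᵐ u ∂volume.restrict (Ioi 0), |κ u| ≤ kt u)
    (hlim : ∀ᵐ u ∂volume.restrict (Ioi 0), Tendsto (fun n => kn n u) atTop (𝓝 (κ u))) :
    Tendsto (fun n => distMu (kn n) κ) atTop (𝓝 0) := by
  have hpos : ∀ᵐ u ∂volume.restrict (Ioi (0 : ℝ)), 0 < u := ae_restrict_mem measurableSet_Ioi
  have hkt2 : IntegrableOn (fun u => 2 * (kt u * min u 1)) (Ioi 0) := Integrable.const_mul hkt 2
  have key : Tendsto (fun n => distMu (kn n) κ) atTop
      (𝓝 (∫⁻ _ in Ioi (0 : ℝ), 0)) := by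
    refine tendsto_lintegral_filter_of_dominated_convergence'
      (fun u => ENNReal.ofReal (2 * (kt u * min u 1))) (Eventually.of_forall fun n => ?_)
      (Eventually.of_forall fun n => ?_) ?_ ?_
    · exact (((hkn n).aestronglyMeasurable.aemeasurable.sub
        hκ.aestronglyMeasurable.aemeasurable).abs.mul
        (by fun_prop : Measurable fun u : ℝ => min u 1).aemeasurable).ennreal_ofReal
    · filter_upwards [hκt, hpos] with u hu hu0
      refine ENNReal.ofReal_le_ofReal ?_
      rw [← mul_assoc]
      refine mul_le_mul_of_nonneg_right ?_ (le_min hu0.le zero_le_one)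
      linarith [abs_sub (kn n u) (κ u), h n u hu0]
    · refine ((hasFiniteIntegral_iff_ofReal ?_).1 hkt2.2).ne
      filter_upwards [hκt, hpos] with u hu hu0
      exact mul_nonneg zero_le_two
        (mul_nonneg ((abs_nonneg _).trans hu) (le_min hu0.le zero_le_one))
    · filter_upwards [hlim] with u hu
      have := ENNReal.tendsto_ofReal (((hu.sub_const (κ u)).abs).mul_const (min u 1))
      simpa using this
  simpa using key

end Convergence

/-! ### Continuity of the inverse of `T`. -/

section Inverse

variable {β b c R : ℝ} {kn : ℕ → ℝ → ℝ} {k kt w : ℝ → ℝ}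

theorem exists_v_eq {a z : ℝ} (hb : 0 < b) (hc : 0 ≤ c) (hz : 0 < z) (hza : z < a) :
    ∃ t, 0 < t ∧ v b c t a = z := by
  have ha := hz.trans hza
  obtain ⟨M, hM, hM0⟩ := (((tendsto_v_atTop hb hc ha.le).eventually (gt_mem_nhds hz)).and
    (eventually_ge_atTop 0)).exists
  have hcont := (continuousOn_v hb hc ha.le).mono (Icc_subset_Ici_self : Icc 0 M ⊆ Ici 0)
  obtain ⟨t, ht, h⟩ := intermediate_value_Icc' hM0 hcont
    ⟨hM.le, by simpa only [v_zero] using hza.le⟩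
  refine ⟨t, lt_of_le_of_ne ht.1 ?_, h⟩
  rintro rfl
  simp only [v_zero] at h
  exact hza.ne' h

/-- Almost every level below `a` is visited by the flow at a dense set of times. -/
theorem exists_mem_Ioo_of_ae {a : ℝ} (hb : 0 < b) (hc : 0 ≤ c) (ha : 0 < a)
    (hw : Icc 0 a ⊆ (weightMeasure w).support) {p : ℝ → Prop} (hp : ∀ᵐ l ∂weightMeasure w, p l)
    {s t : ℝ} (hs : 0 ≤ s) (hst : s < t) : ∃ r ∈ Ioo s t, p (v b c r a) := by
  have ht : 0 ≤ t := hs.trans hst.le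
  have hlt := v_lt_of_lt hb hc hs hst ha
  have hsa : v b c s a ≤ a := by
    refine (v_le_exp_mul hb hc hs ha.le).trans (mul_le_of_le_one_left ha.le ?_)
    exact Real.exp_le_one_iff.2 (by nlinarith)
  obtain ⟨y, hy⟩ := exists_between hlt
  have hysupp : y ∈ (weightMeasure w).support :=
    hw ⟨(v_nonneg hb hc ht ha.le).trans hy.1.le, hy.2.le.trans hsa⟩
  have hpos : 0 < weightMeasure w (Ioo (v b c t a) (v b c s a)) :=
    (Measure.mem_support_iff_forall y).1 hysupp _ (Ioo_mem_nhds hy.1 hy.2)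
  have hne : (Ioo (v b c t a) (v b c s a) ∩ {l | p l}).Nonempty := by
    by_contra! hemp
    refine hpos.ne' (measure_mono_null (t := {l | ¬p l}) (fun l hl hpl => ?_) hp)
    exact notMem_empty l (hemp.subset ⟨hl, hpl⟩)
  obtain ⟨l, hl, hpl⟩ := hne
  have hcont := (continuousOn_v hb hc ha.le).mono
    ((Icc_subset_Ici_self : Icc s t ⊆ Ici s).trans (Ici_subset_Ici.2 hs))
  obtain ⟨r, hr, rfl⟩ := intermediate_value_Ioo' hst.le hcont hl
  exact ⟨r, hr, hpl⟩

/-- A continuous function of time that is constant on a dense set is constant. -/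
theorem eq_of_forall_exists_mem_Ioo {D : ℝ → ℝ} (hD : ContinuousOn D (Ici 0)) {d : ℝ}
    (h : ∀ s t, 0 ≤ s → s < t → ∃ r ∈ Ioo s t, D r = d) {t : ℝ} (ht : 0 ≤ t) : D t = d := by
  have hlim : Tendsto D (𝓝[>] t) (𝓝 (D t)) :=
    ((hD t ht).mono ((Ioi_subset_Ici_self).trans (Ici_subset_Ici.2 ht)))
  refine isClosed_singleton.mem_of_frequently_of_tendsto 
    (?_ : ∃ᶠ s in 𝓝[>] t, D s ∈ ({d} : Set ℝ)) hlim
  intro hev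
  obtain ⟨u, hu, hsub⟩ := mem_nhdsGT_iff_exists_Ioo_subset.1 hev
  obtain ⟨r, hr, hrd⟩ := h t u ht hu
  exact hsub hr hrd

/-- The time derivative of the immigration exponent is `psi` at `v_t(a)`, and the orbit of `a`
sweeps all of `(0, a)` at positive times. -/
theorem psi_eqOn_of_immigration_eq {k₁ k₂ : ℝ → ℝ} (hb : 0 < b) (hc : 0 ≤ c)
    (h₁ : IntegrableMu k₁) (h₂ : IntegrableMu k₂) {a : ℝ}
    (h : ∀ t, 0 ≤ t → immigration β b c k₁ a t = immigration β b c k₂ a t) :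
    EqOn (psi β k₁) (psi β k₂) (Ioo 0 a) := by
  intro z hz
  have ha := hz.1.trans hz.2
  obtain ⟨t, ht, rfl⟩ := exists_v_eq hb hc hz.1 hz.2
  have hder {k : ℝ → ℝ} (hk : IntegrableMu k) :
      HasDerivAt (immigration β b c k a) (psi β k (v b c t a)) t := by
    have hcont := continuousOn_psi_v hb hc hk β ha.le
    refine intervalIntegral.integral_hasDerivAt_right
      (intervalIntegrable_psi_v hb hc hk β ha.le ht.le) ?_
      (hcont.continuousAt (Ici_mem_nhds ht))
    exact (hcont.mono Ioi_subset_Ici_self).stronglyMeasurableAtFilter isOpen_Ioi t ht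
  refine (hder h₁).unique ((hder h₂).congr_of_eventuallyEq ?_)
  filter_upwards [lt_mem_nhds ht] with s hs using h s hs.le

theorem exists_subseq_ae_tendsto_of_sqDistW (hw : Measurable w) {f : ℕ → ℝ → ℝ} {g : ℝ → ℝ}
    (hf : ∀ n, AEMeasurable (f n) (weightMeasure w)) (hg : AEMeasurable g (weightMeasure w))
    (h : Tendsto (fun n => sqDistW w (f n) g) atTop (𝓝 0)) :
    ∃ φ : ℕ → ℕ, StrictMono φ ∧
      ∀ᵐ l ∂weightMeasure w, Tendsto (fun n => f (φ n) l - g l) atTop (𝓝 0) := by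
  have hm (n : ℕ) : AEStronglyMeasurable (fun l => |f n l - g l| ^ 2) (weightMeasure w) := by
    simp only [sq_abs]
    exact (((hf n).sub hg).pow_const 2).aestronglyMeasurable
  have hL : Tendsto (fun n => eLpNorm ((fun l => |f n l - g l| ^ 2) - fun _ => (0 : ℝ)) 1
      (weightMeasure w)) atTop (𝓝 0) := by
    refine h.congr fun n => ?_
    rw [sqDistW_eq hw, eLpNorm_one_eq_lintegral_enorm]
    refine lintegral_congr fun l => ?_
    rw [Pi.sub_apply, sub_zero, Real.enorm_eq_ofReal (by positivity)]
  obtain ⟨φ, hφ, hae⟩ := (tendstoInMeasure_of_tendsto_eLpNorm one_ne_zero hm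
    aestronglyMeasurable_const hL).exists_seq_tendsto_ae
  refine ⟨φ, hφ, hae.mono fun l hl => ?_⟩
  have := hl.sqrt
  simp only [Real.sqrt_sq_eq_abs, abs_abs, Real.sqrt_zero] at this
  exact (tendsto_zero_iff_abs_tendsto_zero _).2 this

/-- `T` has a continuous inverse on `Ψ̃_R`. -/
theorem tendsto_distMu_of_tendsto_sqDistW (hβ : 0 ≤ β) (hb : 0 < b) (hc : 0 ≤ c)
    (hkt : IsInK kt) (hw : IsWeight w) (hkn : ∀ n, IsInKR R kt (kn n))
    (hTn : ∀ n, TFinite b c (kn n)) (hk : IsInKR R kt k) (hT : TFinite b c k)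
    (h : Tendsto (fun n => sqDistW w (T β b c (kn n)) (T β b c k)) atTop (𝓝 0)) :
    Tendsto (fun n => distMu (kn n) k) atTop (𝓝 0) := by
  refine tendsto_of_subseq_tendsto fun ns hns => ?_
  have hkti := hkt.integrableMu
  have hki := hk.inK.integrableMu
  obtain ⟨φ, hφ, κ, hκ⟩ := exists_subseq_tendsto_of_isInKR fun n => hkn (ns n)
  obtain ⟨θ, hθ, hae⟩ := exists_subseq_ae_tendsto_of_sqDistW hw.measurable
    (fun n => aemeasurable_T hβ hb hc (hkn (ns (φ n))).inK.integrableMu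
      (hkn (ns (φ n))).inK.nonneg (hTn _))
    (aemeasurable_T hβ hb hc hki hk.inK.nonneg hT)
    (h.comp (hns.comp hφ.tendsto_atTop))
  refine ⟨φ ∘ θ, ?_⟩
  set q : ℕ → ℝ → ℝ := fun n => kn (ns (φ (θ n))) with hq
  have hqi (n : ℕ) : IntegrableMu (q n) := (hkn _).inK.integrableMu
  have hqb (n : ℕ) (u : ℝ) (hu : 0 < u) : |q n u| ≤ kt u := by
    rw [abs_of_nonneg ((hkn _).inK.nonneg u hu)]
    exact (hkn _).le_envelope u hu
  have hlim : ∀ᵐ u ∂volume.restrict (Ioi 0), Tendsto (fun n => q n u) atTop (𝓝 (κ u)) :=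
    hκ.mono fun u hu => hu.comp hθ.tendsto_atTop
  have hpos : ∀ᵐ u ∂volume.restrict (Ioi (0 : ℝ)), 0 < u := ae_restrict_mem measurableSet_Ioi
  have hκt : ∀ᵐ u ∂volume.restrict (Ioi 0), |κ u| ≤ kt u := by
    filter_upwards [hlim, hpos] with u hu hu0
    exact le_of_tendsto' hu.abs fun n => hqb n u hu0
  have hκ0 : ∀ᵐ u ∂volume.restrict (Ioi 0), 0 ≤ κ u := by
    filter_upwards [hlim, hpos] with u hu hu0
    exact ge_of_tendsto' hu fun n => (hkn _).inK.nonneg u hu0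
  have hκi : IntegrableMu κ := hkti.mono
    (aestronglyMeasurable_of_tendsto_ae _ (fun n => (hqi n).aestronglyMeasurable) hlim) hκt
  obtain ⟨a, ha, hsupp⟩ := hw.support_near_zero
  -- Finiteness of `T κ` is not known, so only finite-time integrals are compared. At good times `D`
  -- takes one common value, by differences along the orbit of `a`; continuity extends this to all
  -- times, and `D 0 = 0` fixes the value.
  set D : ℝ → ℝ := fun t => immigration β b c κ a t - immigration β b c k a t with hD
  have hstep {s t : ℝ} (hs : 0 ≤ s) (ht : 0 ≤ t)
      (h1 : Tendsto (fun n => T β b c (q n) (v b c s a) - T β b c k (v b c s a)) atTop (𝓝 0))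
      (h2 : Tendsto (fun n => T β b c (q n) (v b c t a) - T β b c k (v b c t a)) atTop (𝓝 0)) :
      D s = D t := by
    have hI {r : ℝ} (hr : 0 ≤ r) := tendsto_immigration_of_tendsto hβ hb hc hqi hkti hqb hlim
      ha.le hr
    have h3 := ((hI hs).sub_const (immigration β b c k a s)).sub
      ((hI ht).sub_const (immigration β b c k a t))
    have h4 := h1.sub h2
    rw [sub_zero] at h4
    refine sub_eq_zero.1 (tendsto_nhds_unique (h3.congr fun n => ?_) h4)
    have e {k : ℝ → ℝ} (hk : IsInKR R kt k) (hT : TFinite b c k) {r : ℝ} (hr : 0 ≤ r) :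
        T β b c k (v b c r a) = T β b c k a + immigration β b c k a r :=
      T_v hb hc hk.inK.integrableMu hk.inK.nonneg hT ha hr
    rw [e (hkn _) (hTn _) hs, e (hkn _) (hTn _) ht, e hk hT hs, e hk hT ht]
    ring
  have hDc : ContinuousOn D (Ici 0) := by
    have hc' {k : ℝ → ℝ} (hk : IntegrableMu k) : ContinuousOn (immigration β b c k a) (Ici 0) := by
      intro t ht
      have h1 := intervalIntegral.continuousOn_primitive_interval'
        (intervalIntegrable_psi_v hb hc hk β ha.le (add_nonneg (show 0 ≤ t from ht) zero_le_one))
        left_mem_uIcc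
      rw [uIcc_of_le (add_nonneg (show 0 ≤ t from ht) zero_le_one)] at h1
      refine (h1 t ⟨ht, by linarith⟩).mono_of_mem_nhdsWithin ?_
      rw [← Ici_inter_Iic]
      exact inter_mem self_mem_nhdsWithin (mem_nhdsWithin_of_mem_nhds (Iic_mem_nhds (by linarith)))
    exact (hc' hκi).sub (hc' hki)
  obtain ⟨s, hs, hsT⟩ := exists_mem_Ioo_of_ae hb hc ha hsupp hae le_rfl one_pos
  have hconst {t : ℝ} (ht : 0 ≤ t) : D t = D s :=
    eq_of_forall_exists_mem_Ioo hDc (fun x y hx hxy => by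
      obtain ⟨r, hr, hrT⟩ := exists_mem_Ioo_of_ae hb hc ha hsupp hae hx hxy
      exact ⟨r, hr, hstep (hx.trans hr.1.le) hs.1.le hrT hsT⟩) ht
  have hD0 : D 0 = 0 := by simp [hD, immigration]
  have hpsi := psi_eqOn_of_immigration_eq (β := β) hb hc hκi hki (a := a) fun t ht =>
    sub_eq_zero.1 ((hconst ht).trans ((hconst le_rfl).symm.trans hD0))
  have hkk := ae_eq_of_psi_eqOn hκi hki hκ0
    (hpos.mono fun u hu => hk.inK.nonneg u hu) ha hpsi
  refine tendsto_distMu hqi hkti hqb hki (hpos.mono fun u hu => ?_) ?_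
  · rw [abs_of_nonneg (hk.inK.nonneg u hu)]
    exact hk.le_envelope u hu
  · filter_upwards [hlim, hkk] with u hu hu'
    rwa [← hu']

end Inverse

end CBI

/-! ### Conclusion. -/

theorem theorem4p2 {Ω : Type*} [MeasurableSpace Ω] (P : Measure Ω) [IsProbabilityMeasure P]
    (β b c : ℝ) (hβ : 0 ≤ β) (hb : 0 < b) (hc : 0 ≤ c)
    (R : ℝ) (hR : 0 < R)
    (kt : ℝ → ℝ) (hkt : CBI.IsInK kt) (hktR : CBI.distMu kt 0 ≤ ENNReal.ofReal R)
    (k : ℝ → ℝ) (hk : CBI.IsInKR R kt k)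
    (w : ℝ → ℝ) (hw : CBI.IsWeight w)
    (X : ℝ≥0 → Ω → ℝ≥0) (hX : CBI.IsCBIProcess P β b c k X)
    (hXstat : CBI.IsStationaryProcess P X)
    (ε : ℕ → Ω → ℝ≥0∞) (hε : ∀ᵐ ω ∂P, Tendsto (fun n => ε n ω) atTop (𝓝 0))
    (ghat khat : ℕ → Ω → ℝ → ℝ)
    (hghat : ∀ᵐ ω ∂P, ∀ n : ℕ, 1 ≤ n →
      CBI.IsMinimizerUpTo (ε n ω) β b c R kt w (CBI.logEmpiricalLaplace X n ω) (ghat n ω))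
    (hkhat : ∀ᵐ ω ∂P, ∀ n : ℕ, 1 ≤ n →
      CBI.IsTPreimage β b c R kt w (ghat n ω) (khat n ω)) :
    (∀ᵐ ω ∂P, Tendsto (fun n => CBI.sqDistW w (ghat n ω) (CBI.T β b c k)) atTop (𝓝 0)) ∧
    (∀ᵐ ω ∂P, Tendsto (fun n => CBI.distMu (khat n ω) k) atTop (𝓝 0)) := by
  have hki := hk.inK.integrableMu
  have hT := CBI.tFinite_of_stationary hβ hb hc hki hk.inK.nonneg hX hXstat
  have hg : CBI.IsInPsiR β b c R kt w (CBI.T β b c k) := ⟨k, hk, hT, ae_eq_refl _⟩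
  have hfirst : ∀ᵐ ω ∂P,
      Tendsto (fun n => CBI.sqDistW w (ghat n ω) (CBI.T β b c k)) atTop (𝓝 0) := by
    filter_upwards [CBI.ae_tendsto_sqDistW_logEmpiricalLaplace hβ hb hc hki hk.inK.nonneg hX hXstat
      hw, hε, hghat] with ω h1 h2 h3
    -- This bound comes from the quasi-triangle inequality for squared distances, with the
    -- minimizing property tested against the true `g`.
    have hlim : Tendsto (fun n => 2 * (CBI.sqDistW w (CBI.logEmpiricalLaplace X n ω)
        (CBI.T β b c k) + ε n ω) + 2 * CBI.sqDistW w (CBI.logEmpiricalLaplace X n ω)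
        (CBI.T β b c k)) atTop (𝓝 (2 * (0 + 0) + 2 * 0)) :=
      (ENNReal.Tendsto.const_mul (h1.add h2) (.inr ENNReal.ofNat_ne_top)).add
        (ENNReal.Tendsto.const_mul h1 (.inr ENNReal.ofNat_ne_top))
    simp only [add_zero, mul_zero] at hlim
    refine tendsto_of_tendsto_of_tendsto_of_le_of_le' tendsto_const_nhds hlim
      (Eventually.of_forall fun _ => zero_le) ((eventually_ge_atTop 1).mono fun n hn => ?_)
    have hm : Measurable (CBI.logEmpiricalLaplace X n ω) :=
      ((CBI.measurable_empiricalLaplace hX.1 n).comp measurable_prodMk_left).log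
    refine (CBI.sqDistW_le_add hw.measurable hm.aemeasurable
      (CBI.aemeasurable_T hβ hb hc hki hk.inK.nonneg hT)).trans ?_
    rw [CBI.sqDistW_comm w (ghat n ω)]
    gcongr
    exact (h3 n hn).2 _ hg
  refine ⟨hfirst, ?_⟩
  filter_upwards [hfirst, hkhat] with ω h1 h2
  -- Nothing is assumed about the estimators at index 0, so the sequences are shifted by one.
  rw [← tendsto_add_atTop_iff_nat 1] at h1 ⊢
  refine CBI.tendsto_distMu_of_tendsto_sqDistW hβ hb hc hkt hw
    (fun n => (h2 (n + 1) (by lia)).1) (fun n => (h2 (n + 1) (by lia)).2.1) hk hT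
    (h1.congr fun n => ?_)
  exact CBI.sqDistW_congr_left hw.measurable (h2 (n + 1) (by lia)).2.2
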